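/- **Zeta functions of the Feigenbaum cascade.** Let $f:[0,1]\to[0,1]$ be a $C^3$ unimodal map: $f(0)=f(1)=0$ and $f$ has exactly one critical point $c_0\in(0,1)$. Assume that its Schwarzian derivative is negative on $(0,1)\setminus\{c_0\}$ and that $f'(0)\ge 1$. The kneading sequence $K(f)=s_1s_2s_3\dots$ has $s_i=0$ if $f^{i}(c_0)<c_0$ and $s_i=1$ if $f^{i}(c_0)\ge c_0$. For a sequence $s\in\{0,1\}^{\mathbb N}$ put $t_k\equiv\sum_{i=1}^k s_i \pmod 2$, $t_k\in\{0,1\}$, and $\tau(s)=0.t_1t_2t_3\dots=\sum_{k\ge1}t_k2^{-k}$; the parameter of $f$ is $\tau(K(f))$. The Artin–Mazur zeta function is $\zeta(f,z)=\exp\sum_{n\ge1}\frac{z^n}{n}\,\#\{x\in[0,1]: f^n(x)=x\}$. For $j\ge1$ let $K_j$ be the periodic sequence repeating $\phi^{j-1}(1)$, where $\phi$ is the substitution $1\to10$, $0\to11$ (so $K_1=\overline{1}$, $K_2=\overline{10}$, $K_3=\overline{1011}$, …), let $K_\infty=\lim_j K_j$, and put $\tau_j=\tau(K_j)$, $\tau_\infty=\tau(K_\infty)$.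 Then: 1. If $f$ has parameter $\tau_j$ $(j\ge1)$ and has a periodic attractor of least period $2^j$, then every iterate $f^n$ $(n\ge1)$ has finitely many fixed points, the series defining $\zeta(f,z)$ converges absolutely for $|z|<1$, and there $$\frac1{\zeta(f,z)}=(1-z)\prod_{n=0}^{j}\bigl(1-z^{2^n}\bigr).$$ All zeros in $\mathbb C$ of the polynomial on the right lie on the unit circle. We write $\zeta(\tau_j,z)$ for this $\zeta(f,z)$. 2. $\tau_j\to\tau_\infty$, and the product $\Xi(z)=\prod_{n\ge0}(1-z^{2^n})$ converges for $|z|<1$. If $f$ has parameter $\tau_\infty$, then every $f^n$ $(n\ge1)$ has finitely many fixed points, the series defining $\zeta(f,z)=:\zeta(\tau_\infty,z)$ converges absolutely for $|z|<1$, and there $1/\zeta(\tau_\infty,z)=(1-z)\,\Xi(z)$. 3. As $j\to\infty$, the polynomials $(1-z)\prod_{n=0}^{j}(1-z^{2^n})$ converge to $(1-z)\,\Xi(z)$, and $\zeta(\tau_j,z)\to\zeta(\tau_\infty,z)$ and $1/\zeta(\tau_j,z)\to1/\zeta(\tau_\infty,z)$, locally uniformly on $|z|<1$. 4. For $|z|<1$,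 $\Xi(z)=\sum_{k\ge0}\epsilon_kz^k$ with $\epsilon_0=1$ and $\epsilon_k=1-2t_k$ for $k\ge 1$, where $\tau_\infty=0.t_1t_2t_3\dots$ is the expansion obtained from $K_\infty$. -/

import Mathlib

open Set Filter Topology

namespace Feigenbaum

/-! ### Symbolic sequences

A sequence `s₁ s₂ s₃ …` of symbols `0`, `1` is a function `s : ℕ → ℕ` with `s i` standing for
the symbol `s_{i+1}`. -/

/-- The digit `t_k = s₁ + ⋯ + s_k (mod 2)`; in particular `t_0 = 0`. -/
def digit (s : ℕ → ℕ) (k : ℕ) : ℕ := (∑ i ∈ Finset.range k, s i) % 2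

/-- The sign `ε_k = 1 - 2 t_k`. -/
def sign (s : ℕ → ℕ) (k : ℕ) : ℤ := 1 - 2 * (digit s k : ℤ)

/-- The number `τ(s) = 0.t₁t₂t₃… = ∑_{k ≥ 1} t_k / 2 ^ k`. The series always converges. -/
noncomputable def tau (s : ℕ → ℕ) : ℝ := ∑' k : ℕ, (digit s (k + 1) : ℝ) / 2 ^ (k + 1)

/-! ### Unimodal maps of the interval `[0, 1]` -/

/-- `f` restricts to a (`C³`) unimodal map of `[0, 1]` with critical point `c`. Only the values of
`f` on `[0, 1]` matter. -/
structure IsUnimodal (f : ℝ → ℝ) (c : ℝ) : Prop where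
  mapsTo : MapsTo f (Icc 0 1) (Icc 0 1)
  smooth : ContDiffOn ℝ 3 f (Icc 0 1)
  crit_mem : c ∈ Ioo (0 : ℝ) 1
  crit_iff : ∀ x ∈ Icc (0 : ℝ) 1, derivWithin f (Icc 0 1) x = 0 ↔ x = c
  map_zero : f 0 = 0
  map_one : f 1 = 0

/-- The Schwarzian derivative `f''' / f' - (3 / 2) (f'' / f')²` of a map of `[0, 1]`. -/
noncomputable def schwarzian (f : ℝ → ℝ) (x : ℝ) : ℝ :=
  iteratedDerivWithin 3 f (Icc 0 1) x / derivWithin f (Icc 0 1) x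
    - 3 / 2 * (iteratedDerivWithin 2 f (Icc 0 1) x / derivWithin f (Icc 0 1) x) ^ 2

/-- Unimodal maps with negative Schwarzian derivative off the critical point, whose boundary
fixed point `0` satisfies `f'(0) ≥ 1`. -/
structure IsSUnimodal (f : ℝ → ℝ) (c : ℝ) : Prop extends IsUnimodal f c where
  schwarzian_neg : ∀ x ∈ Ioo (0 : ℝ) 1, x ≠ c → schwarzian f x < 0
  one_le_deriv_zero : 1 ≤ derivWithin f (Icc 0 1) 0

/-- The itinerary of `x`: the `i`-th symbol is `0` or `1` according to `fⁱ(x) < c` or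
`fⁱ(x) ≥ c` (with `i` counted from `0`). -/
noncomputable def itinerary (f : ℝ → ℝ) (c x : ℝ) (i : ℕ) : ℕ :=
  if f^[i] x < c then 0 else 1

/-- The kneading sequence: the itinerary of the critical value. -/
noncomputable def kneading (f : ℝ → ℝ) (c : ℝ) : ℕ → ℕ := itinerary f c (f c)

/-- The parameter `τ(K(f))` of a unimodal map. -/
noncomputable def parameter (f : ℝ → ℝ) (c : ℝ) : ℝ := tau (kneading f c)

/-- `f` has a periodic attractor of (least) period `p` in `[0, 1]`: a point of least period `p`
such that all points of `[0, 1]` near it converge to it under iteration of `f ^ p`. -/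
def HasPeriodicAttractor (f : ℝ → ℝ) (p : ℕ) : Prop :=
  ∃ x ∈ Icc (0 : ℝ) 1, Function.minimalPeriod f x = p ∧ 0 < p ∧
    ∀ᶠ y in 𝓝[Icc 0 1] x, Tendsto (fun n : ℕ => f^[n * p] y) atTop (𝓝 x)

/-! ### The Artin–Mazur zeta function -/

/-- The set `Per_n(f)` of the points of `[0, 1]` fixed by the `n`-th iterate of `f`. -/
def per (f : ℝ → ℝ) (n : ℕ) : Set ℝ := {x ∈ Icc (0 : ℝ) 1 | Function.IsPeriodicPt f n x}

/-- The term `(z ^ n / n) · #Per_n(f)`, for `n ≥ 1`. -/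
noncomputable def zetaTerm (f : ℝ → ℝ) (z : ℂ) (n : ℕ) : ℂ :=
  z ^ n / (n : ℂ) * ((per f n).ncard : ℂ)

/-- `ζ(f, z) = exp ∑_{n ≥ 1} (z ^ n / n) #Per_n(f)`. -/
noncomputable def zeta (f : ℝ → ℝ) (z : ℂ) : ℂ := Complex.exp (∑' n : ℕ, zetaTerm f z (n + 1))

/-- The zeta function of `f` is defined on the open unit disc: all the numbers `#Per_n(f)`,
`n ≥ 1`, are finite, and the series in its definition converges absolutely for `|z| < 1`. -/
def ZetaDefined (f : ℝ → ℝ) : Prop :=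
  (∀ n : ℕ, 1 ≤ n → (per f n).Finite) ∧
    ∀ z : ℂ, ‖z‖ < 1 → Summable (fun n : ℕ => ‖zetaTerm f z (n + 1)‖)

/-! ### The Feigenbaum cascade -/

/-- The Feigenbaum substitution `1 → 10`, `0 → 11`. -/
def subst (a : ℕ) : List ℕ := if a = 1 then [1, 0] else [1, 1]

/-- The words `1`, `10`, `1011`, `10111010`, … : `word m` has length `2 ^ m`. -/
def word : ℕ → List ℕ
  | 0 => [1]
  | m + 1 => (word m).flatMap subst

/-- For `j ≥ 1`, the periodic sequence `K_j` that repeats the `j`-th of these words: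
`K_1` repeats `1`, `K_2` repeats `10`, `K_3` repeats `1011`, and so on. -/
def K (j : ℕ) (i : ℕ) : ℕ := (word (j - 1)).getD (i % (word (j - 1)).length) 0

/-- The limit sequence `K_∞ = 1011 1010 1011 1011 …`. -/
def Kinf (i : ℕ) : ℕ := (word i).getD i 0

/-- `τ_j = τ(K_j)`, for `j ≥ 1`. -/
noncomputable def tauJ (j : ℕ) : ℝ := tau (K j)

/-- `τ_∞ = τ(K_∞)`. -/
noncomputable def tauInf : ℝ := tau Kinf

/-- The polynomial `(1 - z) ∏_{n=0}^{j} (1 - z ^ (2 ^ n))`. -/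
noncomputable def cascadePoly (j : ℕ) : Polynomial ℂ :=
  (1 - Polynomial.X) * ∏ n ∈ Finset.range (j + 1), (1 - Polynomial.X ^ 2 ^ n)

/-- `Ξ(z) = ∏_{n ≥ 0} (1 - z ^ (2 ^ n))`. -/
noncomputable def Xi (z : ℂ) : ℂ := ∏' n : ℕ, (1 - z ^ 2 ^ n)

theorem word_length (m : ℕ) : (word m).length = 2 ^ m := by
  have hs : ∀ l : List ℕ, (l.flatMap subst).length = 2 * l.length := by
    intro l
    induction l with
    | nil => simp
    | cons a l ih =>
      have ha : (subst a).length = 2 := by unfold subst; split_ifs <;> rfl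
      simp only [List.flatMap_cons, List.length_append, List.length_cons, ih, ha]
      ring
  induction m with
  | zero => rfl
  | succ m ih => rw [word, hs, ih, pow_succ]; ring

theorem word_prefix_succ (m : ℕ) : word m <+: word (m + 1) := by
  induction m with
  | zero => exact ⟨[0], rfl⟩
  | succ m ih =>
    obtain ⟨l, hl⟩ := ih
    refine ⟨l.flatMap subst, ?_⟩
    change (word m).flatMap subst ++ l.flatMap subst = (word (m + 1)).flatMap subst
    rw [← hl, List.flatMap_append]

theorem word_prefix {m n : ℕ} (h : m ≤ n) : word m <+: word n := by
  induction n, h using Nat.le_induction with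
  | base => exact List.prefix_refl _
  | succ n _ ih => exact ih.trans (word_prefix_succ n)

/-- `K_∞` is the limit of the sequences `K_j`: each symbol is eventually constant in `j`. -/
theorem K_eq_Kinf {i j : ℕ} (h : i < j) : K j i = Kinf i := by
  have hi : i < (word i).length := by rw [word_length]; exact Nat.lt_two_pow_self
  have hij : word i <+: word (j - 1) := word_prefix (by omega)
  have hj : i < (word (j - 1)).length := hi.trans_le hij.length_le
  obtain ⟨l, hl⟩ := hij
  unfold K Kinf
  rw [Nat.mod_eq_of_lt hj, ← hl, List.getD_append _ _ _ _ hi]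

end Feigenbaum

/-!
The proof counts periodic points by renormalization; no kneading theory or general theory of
attractors is needed.

Negative Schwarzian derivative enters through the minimum principle `min_lt_of_negSchwarzian`: a
positive derivative has no interior local minimum. Together with `f'(0) ≥ 1` it shows `f x > x` on
`(0, c)` as soon as `f c ≥ c` (`IsSUnimodal.lt_map`), so every periodic point other than `0` lies in
`[f (f c), f c]` (`IsSUnimodal.mem_Icc_of_isPeriodicPt`).

Suppose `f c > c` and the critical orbit follows the image of a sequence `s'` under the substitution
`1 → 10`, `0 → 11`. Let `p` be the fixed point to the right of `c` and `q` its other preimage. Then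
`f` interchanges `[q, p]` and `[p, f c]`, and `f ∘ f` on `[q, p]`, rescaled with reversed
orientation, is again unimodal with negative Schwarzian derivative; its boundary fixed point has
derivative `f'(p)² ≥ 1`, once more by the minimum principle (`Renormalizable.one_le_deriv_sq`).
Its critical orbit follows `s'`. Hence an iterate of odd order has two fixed points, and one of
order `2 n` has twice as many as the `n`-th iterate of the renormalization
(`Renormalizable.ncard_per_odd`, `Renormalizable.ncard_per_even`).

For `τ_j` this reduces the count to `j = 1`, where all points of the critical orbit lie to the right
of `c`. There `f ∘ f` is increasing on the interval containing the periodic points, and an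
increasing map with negative Schwarzian derivative has at most three fixed points
(`not_four_fixed`); the attractor is only needed to know that the orbit of period two exists. For
`τ_∞` the count for the `n`-th iterate is complete after `⌈log₂ (n + 1)⌉` renormalizations. To have
a notion that survives renormalization also when the critical point is periodic, `Follows` allows
both symbols for the critical point.

The parameter determines the kneading sequence, because the sequences `K_j` and `K_∞` have
infinitely many symbols `1` (`eq_of_tau_eq`). The zeta function at `τ_j` is then a product over
the periodic orbits, and the one at `τ_∞` is the limit of these, by dominated convergence of the
logarithms. The signs `ε_k` are the Thue–Morse signs, `ε_{2k} = ε_k` and `ε_{2k+1} = -ε_k`, because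
`K_∞` is fixed by the substitution; they are the coefficients of the partial products of `Ξ`.
-/

namespace Feigenbaum

/-! ### Negative Schwarzian derivative -/

/-- The numerator `h''' h' - (3 / 2) h''²` of the Schwarzian derivative: the Schwarzian derivative
multiplied by `h'²`, hence of the same sign where `h' ≠ 0`. -/
noncomputable def schwarzianNum (h : ℝ → ℝ) (x : ℝ) : ℝ :=
  deriv (deriv (deriv h)) x * deriv h x - 3 / 2 * (deriv (deriv h) x) ^ 2

/-- `h` is `C³` at `x`, `x` is not critical, and the Schwarzian derivative is negative at `x`. -/
structure NegSchwarzianAt (h : ℝ → ℝ) (x : ℝ) : Prop where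
  contDiffAt : ContDiffAt ℝ 3 h x
  deriv_ne_zero : deriv h x ≠ 0
  num_neg : schwarzianNum h x < 0

theorem contDiffAt_deriv {h : ℝ → ℝ} {x : ℝ} {m n : ℕ} (hh : ContDiffAt ℝ n h x)
    (hmn : m + 1 ≤ n) : ContDiffAt ℝ m (deriv h) x := by
  have h1 : ContDiffAt ℝ m (fderiv ℝ h) x := hh.fderiv_right (by exact_mod_cast hmn)
  exact h1.clm_apply contDiffAt_const

/-- The chain rule for the numerator of the Schwarzian derivative. -/
theorem schwarzianNum_comp {h k : ℝ → ℝ} {x : ℝ} (hh : ContDiffAt ℝ 3 h (k x))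
    (hk : ContDiffAt ℝ 3 k x) :
    schwarzianNum (h ∘ k) x
      = schwarzianNum h (k x) * deriv k x ^ 4 + deriv h (k x) ^ 2 * schwarzianNum k x := by
  have evh : ∀ᶠ y in 𝓝 x, ContDiffAt ℝ 3 h (k y) :=
    hk.continuousAt.eventually (hh.eventually (by simp))
  have evk : ∀ᶠ y in 𝓝 x, ContDiffAt ℝ 3 k y := hk.eventually (by simp)
  have e1 : deriv (h ∘ k) =ᶠ[𝓝 x] fun y => deriv h (k y) * deriv k y := by
    filter_upwards [evh, evk] with y h1 h2
    exact deriv_comp y (h1.differentiableAt (by simp)) (h2.differentiableAt (by simp))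
  have e2 : deriv (deriv (h ∘ k)) =ᶠ[𝓝 x] fun y =>
      deriv (deriv h) (k y) * deriv k y ^ 2 + deriv h (k y) * deriv (deriv k) y := by
    filter_upwards [evh, evk, e1.eventuallyEq_nhds] with y h1 h2 h3
    rw [h3.deriv_eq]
    have d1 : DifferentiableAt ℝ (deriv h) (k y) :=
      (contDiffAt_deriv (m := 2) (n := 3) h1 le_rfl).differentiableAt (by simp)
    have d2 : DifferentiableAt ℝ (deriv k) y :=
      (contDiffAt_deriv (m := 2) (n := 3) h2 le_rfl).differentiableAt (by simp)
    have d3 : DifferentiableAt ℝ k y := h2.differentiableAt (by simp)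
    have := ((d1.hasDerivAt.comp y d3.hasDerivAt).mul d2.hasDerivAt).deriv
    refine Eq.trans this ?_
    simp only [Function.comp]
    ring
  have e3 : deriv (deriv (deriv (h ∘ k))) x = deriv (deriv (deriv h)) (k x) * deriv k x ^ 3
      + 3 * deriv (deriv h) (k x) * deriv k x * deriv (deriv k) x
      + deriv h (k x) * deriv (deriv (deriv k)) x := by
    rw [e2.deriv_eq]
    have a1 := contDiffAt_deriv (m := 2) (n := 3) hh le_rfl
    have a2 := contDiffAt_deriv (m := 2) (n := 3) hk le_rfl
    have d1 : DifferentiableAt ℝ (deriv h) (k x) := a1.differentiableAt (by simp)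
    have d2 : DifferentiableAt ℝ (deriv k) x := a2.differentiableAt (by simp)
    have d3 : DifferentiableAt ℝ k x := hk.differentiableAt (by simp)
    have d4 : DifferentiableAt ℝ (deriv (deriv h)) (k x) :=
      (contDiffAt_deriv (m := 1) (n := 2) a1 le_rfl).differentiableAt (by simp)
    have d5 : DifferentiableAt ℝ (deriv (deriv k)) x :=
      (contDiffAt_deriv (m := 1) (n := 2) a2 le_rfl).differentiableAt (by simp)
    have := (((d4.hasDerivAt.comp x d3.hasDerivAt).mul (d2.hasDerivAt.pow 2)).add
      ((d1.hasDerivAt.comp x d3.hasDerivAt).mul d5.hasDerivAt)).deriv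
    refine Eq.trans this ?_
    simp only [Function.comp, Pi.pow_apply]
    ring
  unfold schwarzianNum
  rw [e3, e2.self_of_nhds, e1.self_of_nhds]
  ring

theorem NegSchwarzianAt.comp {h k : ℝ → ℝ} {x : ℝ} (hh : NegSchwarzianAt h (k x))
    (hk : NegSchwarzianAt k x) : NegSchwarzianAt (h ∘ k) x where
  contDiffAt := hh.contDiffAt.comp x hk.contDiffAt
  deriv_ne_zero := by
    rw [deriv_comp x (hh.contDiffAt.differentiableAt (by simp))
      (hk.contDiffAt.differentiableAt (by simp))]
    exact mul_ne_zero hh.deriv_ne_zero hk.deriv_ne_zero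
  num_neg := by
    rw [schwarzianNum_comp hh.contDiffAt hk.contDiffAt]
    have h1 : 0 < deriv k x ^ 4 := by have := hk.deriv_ne_zero; positivity
    have h2 : 0 < deriv h (k x) ^ 2 := by have := hh.deriv_ne_zero; positivity
    have := mul_neg_of_neg_of_pos hh.num_neg h1
    have := mul_neg_of_pos_of_neg h2 hk.num_neg
    linarith

theorem hasDerivAt_affine (a b x : ℝ) : HasDerivAt (fun t : ℝ => a + b * t) b x := by
  simpa using ((hasDerivAt_id x).const_mul b).const_add a

theorem schwarzianNum_affine (a b x : ℝ) : schwarzianNum (fun t => a + b * t) x = 0 := by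
  have h1 : deriv (fun t : ℝ => a + b * t) = fun _ => b :=
    funext fun t => (hasDerivAt_affine a b t).deriv
  simp [schwarzianNum, h1]

theorem contDiffAt_affine (a b x : ℝ) : ContDiffAt ℝ 3 (fun t : ℝ => a + b * t) x := by
  fun_prop

theorem NegSchwarzianAt.comp_affine {h : ℝ → ℝ} {a b x : ℝ} (hb : b ≠ 0)
    (hh : NegSchwarzianAt h (a + b * x)) : NegSchwarzianAt (h ∘ fun t => a + b * t) x where
  contDiffAt := ContDiffAt.comp (f := fun t : ℝ => a + b * t) x hh.contDiffAt
    (contDiffAt_affine a b x)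
  deriv_ne_zero := by
    rw [deriv_comp (h₂ := h) (h := fun t => a + b * t) x (hh.contDiffAt.differentiableAt (by simp))
      (hasDerivAt_affine a b x).differentiableAt, (hasDerivAt_affine a b x).deriv]
    exact mul_ne_zero hh.deriv_ne_zero hb
  num_neg := by
    rw [schwarzianNum_comp (h := h) (k := fun t => a + b * t) hh.contDiffAt
      (contDiffAt_affine a b x), schwarzianNum_affine, (hasDerivAt_affine a b x).deriv]
    have := mul_neg_of_neg_of_pos hh.num_neg (show 0 < b ^ 4 by positivity)
    linarith

theorem NegSchwarzianAt.affine_comp {h : ℝ → ℝ} {a b x : ℝ} (hb : b ≠ 0)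
    (hh : NegSchwarzianAt h x) : NegSchwarzianAt ((fun t => a + b * t) ∘ h) x where
  contDiffAt := (contDiffAt_affine a b (h x)).comp x hh.contDiffAt
  deriv_ne_zero := by
    rw [deriv_comp (h₂ := fun t => a + b * t) x (hasDerivAt_affine a b _).differentiableAt
      (hh.contDiffAt.differentiableAt (by simp)), (hasDerivAt_affine a b _).deriv]
    exact mul_ne_zero hb hh.deriv_ne_zero
  num_neg := by
    rw [schwarzianNum_comp (h := fun t => a + b * t) (contDiffAt_affine a b _) hh.contDiffAt,
      schwarzianNum_affine, (hasDerivAt_affine a b _).deriv]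
    have := mul_neg_of_pos_of_neg (show 0 < b ^ 2 by positivity) hh.num_neg
    linarith

/-- The minimum principle: where the Schwarzian derivative is negative, a positive derivative has
no local minimum. The derivative is given as a function `u` so as to allow one-sided derivatives
at the endpoints. -/
theorem min_lt_of_negSchwarzian {h u : ℝ → ℝ} {a b z : ℝ}
    (hu : ContinuousOn u (Icc a b)) (hderiv : EqOn u (deriv h) (Ioo a b))
    (hneg : ∀ x ∈ Ioo a b, NegSchwarzianAt h x) (hpos : ∀ x ∈ Ioo a b, 0 < u x)
    (hz : z ∈ Ioo a b) : min (u a) (u b) < u z := by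
  by_contra! hle
  -- a minimum of `u` over `[a, b]` is attained at an interior point
  obtain ⟨w, hw, hmin⟩ : ∃ w ∈ Ioo a b, ∀ y ∈ Icc a b, u w ≤ u y := by
    obtain ⟨w, hw, hmin⟩ := isCompact_Icc.exists_isMinOn (nonempty_Icc.2 (hz.1.trans hz.2).le) hu
    rcases eq_or_lt_of_le hw.1 with rfl | hw1
    · exact ⟨z, hz, fun y hy => (hle.trans (min_le_left _ _)).trans (hmin hy)⟩
    rcases eq_or_lt_of_le hw.2 with rfl | hw2
    · exact ⟨z, hz, fun y hy => (hle.trans (min_le_right _ _)).trans (hmin hy)⟩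
    exact ⟨w, ⟨hw1, hw2⟩, fun y hy => hmin hy⟩
  have hnhds : Ioo a b ∈ 𝓝 w := Ioo_mem_nhds hw.1 hw.2
  have hlmin : IsLocalMin (deriv h) w := by
    filter_upwards [hnhds] with y hy
    rw [← hderiv hw, ← hderiv hy]
    exact hmin y (Ioo_subset_Icc_self hy)
  have h2 : deriv (deriv h) w = 0 := hlmin.deriv_eq_zero
  have hS := (hneg w hw).num_neg
  have hp : 0 < deriv h w := by rw [← hderiv hw]; exact hpos w hw
  have h3 : deriv (deriv (deriv h)) w < 0 := by
    simp only [schwarzianNum, h2] at hS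
    by_contra! hc
    have := mul_nonneg hc hp.le
    linarith
  have hc1 : ContinuousAt (deriv h) w :=
    (contDiffAt_deriv (m := 2) (n := 3) (hneg w hw).contDiffAt le_rfl).continuousAt
  have hlmax : IsLocalMax (deriv h) w := isLocalMax_of_deriv_deriv_neg h3 h2 hc1
  -- `h'` is locally constant at `w`, so `h'''` vanishes there
  have hconst : deriv h =ᶠ[𝓝 w] fun _ => deriv h w := by
    filter_upwards [hlmin, hlmax] with y h4 h5
    exact le_antisymm h5 h4
  have := hconst.deriv.deriv_eq
  simp at this
  linarith

/-- A map with positive derivative and negative Schwarzian derivative does not have four fixed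
points: the three points between them with derivative `1` would violate the minimum principle. -/
theorem not_four_fixed {h : ℝ → ℝ} {a b c d : ℝ} (hab : a < b) (hbc : b < c) (hcd : c < d)
    (hcont : ContinuousOn h (Icc a d)) (hneg : ∀ x ∈ Ioo a d, NegSchwarzianAt h x)
    (hpos : ∀ x ∈ Ioo a d, 0 < deriv h x)
    (ha : h a = a) (hb : h b = b) (hc : h c = c) (hd : h d = d) : False := by
  have key : ∀ u v, a ≤ u → u < v → v ≤ d → h u = u → h v = v →
      ∃ y ∈ Ioo u v, deriv h y = 1 := by
    intro u v hau huv hvd hu hv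
    obtain ⟨y, hy, hy1⟩ := exists_deriv_eq_slope h huv
      (hcont.mono (Icc_subset_Icc hau hvd)) (fun y hy =>
        ((hneg y ⟨hau.trans_lt hy.1, hy.2.trans_le hvd⟩).contDiffAt.differentiableAt
          (by simp)).differentiableWithinAt)
    refine ⟨y, hy, ?_⟩
    rw [hy1, hu, hv, div_self (by linarith)]
  obtain ⟨y₁, h₁, e₁⟩ := key a b le_rfl hab (by linarith) ha hb
  obtain ⟨y₂, h₂, e₂⟩ := key b c hab.le hbc hcd.le hb hc
  obtain ⟨y₃, h₃, e₃⟩ := key c d (by linarith) hcd le_rfl hc hd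
  have hsub : Icc y₁ y₃ ⊆ Ioo a d := fun x hx => ⟨h₁.1.trans_le hx.1, hx.2.trans_lt h₃.2⟩
  have := min_lt_of_negSchwarzian (h := h) (u := deriv h) (a := y₁) (b := y₃) (z := y₂)
    (fun x hx => (contDiffAt_deriv (m := 2) (n := 3) (hneg x (hsub hx)).contDiffAt
      le_rfl).continuousAt.continuousWithinAt) (fun _ _ => rfl)
    (fun x hx => hneg x (hsub (Ioo_subset_Icc_self hx)))
    (fun x hx => hpos x (hsub (Ioo_subset_Icc_self hx)))
    ⟨h₁.2.trans h₂.1, h₂.2.trans h₃.1⟩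
  simp [e₁, e₂, e₃] at this

/-! ### Unimodal maps -/

theorem iteratedDerivWithin_Icc {f : ℝ → ℝ} {x : ℝ} (hx : x ∈ Ioo (0 : ℝ) 1) (n : ℕ) :
    iteratedDerivWithin n f (Icc 0 1) x = iteratedDeriv n f x := by
  have : (Icc (0 : ℝ) 1) =ᶠ[𝓝 x] univ := by
    filter_upwards [Icc_mem_nhds hx.1 hx.2] with y hy
    exact eq_true hy |>.trans (eq_true (mem_univ y)).symm
  rw [iteratedDerivWithin, iteratedDeriv, iteratedFDerivWithin_congr_set this,
    iteratedFDerivWithin_univ]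

theorem derivWithin_Icc {f : ℝ → ℝ} {x : ℝ} (hx : x ∈ Ioo (0 : ℝ) 1) :
    derivWithin f (Icc 0 1) x = deriv f x :=
  derivWithin_of_mem_nhds (Icc_mem_nhds hx.1 hx.2)

theorem schwarzian_neg_iff {f : ℝ → ℝ} {x : ℝ} (hx : x ∈ Ioo (0 : ℝ) 1) (hd : deriv f x ≠ 0) :
    schwarzian f x < 0 ↔ schwarzianNum f x < 0 := by
  have h2 : 0 < deriv f x ^ 2 := by positivity
  have : schwarzianNum f x = schwarzian f x * deriv f x ^ 2 := by
    simp only [schwarzian, schwarzianNum, iteratedDerivWithin_Icc hx, derivWithin_Icc hx,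
      iteratedDeriv_succ, iteratedDeriv_zero]
    field_simp
  rw [this]
  constructor
  · intro h; exact mul_neg_of_neg_of_pos h h2
  · intro h; by_contra! hc; have := mul_nonneg hc h2.le; linarith

namespace IsUnimodal

variable {f : ℝ → ℝ} {c : ℝ}

theorem continuousOn (hf : IsUnimodal f c) : ContinuousOn f (Icc 0 1) := hf.smooth.continuousOn

theorem contDiffAt (hf : IsUnimodal f c) {x : ℝ} (hx : x ∈ Ioo (0 : ℝ) 1) : ContDiffAt ℝ 3 f x :=
  hf.smooth.contDiffAt (Icc_mem_nhds hx.1 hx.2)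

theorem differentiableAt (hf : IsUnimodal f c) {x : ℝ} (hx : x ∈ Ioo (0 : ℝ) 1) :
    DifferentiableAt ℝ f x := (hf.contDiffAt hx).differentiableAt (by simp)

theorem deriv_eq_zero_iff (hf : IsUnimodal f c) {x : ℝ} (hx : x ∈ Ioo (0 : ℝ) 1) :
    deriv f x = 0 ↔ x = c := by
  rw [← derivWithin_Icc hx, hf.crit_iff x (Ioo_subset_Icc_self hx)]

theorem injOn_of_notMem (hf : IsUnimodal f c) {a b : ℝ} (ha : 0 ≤ a) (hb : b ≤ 1)
    (hc : c ∉ Ioo a b) : InjOn f (Icc a b) := by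
  have key : ∀ x ∈ Icc a b, ∀ y ∈ Icc a b, x < y → f x ≠ f y := by
    intro x hx y hy hxy he
    obtain ⟨z, hz, hz0⟩ := exists_deriv_eq_zero hxy (hf.continuousOn.mono
      (Icc_subset_Icc (ha.trans hx.1) (hy.2.trans hb))) he
    rw [hf.deriv_eq_zero_iff ⟨(ha.trans hx.1).trans_lt hz.1, hz.2.trans_le (hy.2.trans hb)⟩] at hz0
    subst hz0
    exact hc ⟨hx.1.trans_lt hz.1, hz.2.trans_le hy.2⟩
  intro x hx y hy he
  rcases lt_trichotomy x y with h | h | h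
  · exact absurd he (key x hx y hy h)
  · exact h
  · exact absurd he.symm (key y hy x hx h)

theorem crit_mem_Icc (hf : IsUnimodal f c) : c ∈ Icc (0 : ℝ) 1 := Ioo_subset_Icc_self hf.crit_mem

theorem strictMonoOn (hf : IsUnimodal f c) : StrictMonoOn f (Icc 0 c) := by
  have hc := hf.crit_mem
  rcases (hf.continuousOn.mono (Icc_subset_Icc_right hc.2.le)).strictMonoOn_of_injOn_Icc' hc.1.le
    (hf.injOn_of_notMem le_rfl hc.2.le (fun h => lt_irrefl _ h.2)) with h | h
  · exact h
  · have h1 := h (left_mem_Icc.2 hc.1.le) (right_mem_Icc.2 hc.1.le) hc.1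
    have h2 := (hf.mapsTo hf.crit_mem_Icc).1
    rw [hf.map_zero] at h1
    linarith

theorem strictAntiOn (hf : IsUnimodal f c) : StrictAntiOn f (Icc c 1) := by
  have hc := hf.crit_mem
  rcases (hf.continuousOn.mono (Icc_subset_Icc_left hc.1.le)).strictMonoOn_of_injOn_Icc' hc.2.le
    (hf.injOn_of_notMem hc.1.le le_rfl (fun h => lt_irrefl _ h.1)) with h | h
  · have h1 := h (left_mem_Icc.2 hc.2.le) (right_mem_Icc.2 hc.2.le) hc.2
    have h2 := (hf.mapsTo hf.crit_mem_Icc).1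
    rw [hf.map_one] at h1
    linarith
  · exact h

theorem le_map_crit (hf : IsUnimodal f c) {x : ℝ} (hx : x ∈ Icc (0 : ℝ) 1) : f x ≤ f c := by
  have hc := hf.crit_mem
  rcases le_total x c with h | h
  · exact hf.strictMonoOn.monotoneOn ⟨hx.1, h⟩ ⟨hc.1.le, le_rfl⟩ h
  · exact hf.strictAntiOn.antitoneOn ⟨le_rfl, hc.2.le⟩ ⟨h, hx.2⟩ h

theorem deriv_pos (hf : IsUnimodal f c) {x : ℝ} (hx : x ∈ Ioo 0 c) : 0 < deriv f x := by
  have hc := hf.crit_mem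
  have hx1 : x ∈ Ioo (0 : ℝ) 1 := ⟨hx.1, hx.2.trans hc.2⟩
  refine lt_of_le_of_ne ?_ (fun h => hx.2.ne ((hf.deriv_eq_zero_iff hx1).1 h.symm))
  have hn : Icc 0 c ∈ 𝓝 x := Icc_mem_nhds hx.1 hx.2
  rw [← derivWithin_of_mem_nhds hn]
  exact hf.strictMonoOn.monotoneOn.derivWithin_nonneg

theorem deriv_neg (hf : IsUnimodal f c) {x : ℝ} (hx : x ∈ Ioo c 1) : deriv f x < 0 := by
  have hc := hf.crit_mem
  have hx1 : x ∈ Ioo (0 : ℝ) 1 := ⟨hc.1.trans hx.1, hx.2⟩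
  refine lt_of_le_of_ne ?_ (fun h => hx.1.ne' ((hf.deriv_eq_zero_iff hx1).1 h))
  have hn : Icc c 1 ∈ 𝓝 x := Icc_mem_nhds hx.1 hx.2
  rw [← derivWithin_of_mem_nhds hn]
  exact hf.strictAntiOn.antitoneOn.derivWithin_nonpos

end IsUnimodal

namespace IsSUnimodal

variable {f : ℝ → ℝ} {c : ℝ}

theorem negSchwarzianAt (hf : IsSUnimodal f c) {x : ℝ} (hx : x ∈ Ioo (0 : ℝ) 1) (hxc : x ≠ c) :
    NegSchwarzianAt f x := by
  have h0 : deriv f x ≠ 0 := fun h => hxc ((hf.toIsUnimodal.deriv_eq_zero_iff hx).1 h)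
  exact ⟨hf.toIsUnimodal.contDiffAt hx, h0,
    (schwarzian_neg_iff hx h0).1 (hf.schwarzian_neg x hx hxc)⟩

/-- If the critical point does not move to the left, every point of `(0, c)` moves to the right.
Otherwise the mean value theorem gives points where `f'` is `≤ 1`, `≥ 1`, in this order, and
`f'(0) ≥ 1`, against the minimum principle. -/
theorem lt_map (hf : IsSUnimodal f c) (hc1 : c ≤ f c) {x : ℝ} (hx : x ∈ Ioo 0 c) : x < f x := by
  by_contra! hle
  have hU := hf.toIsUnimodal
  have hc := hU.crit_mem
  obtain ⟨z, hz, hz1⟩ := exists_deriv_eq_slope f hx.1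
    (hU.continuousOn.mono (Icc_subset_Icc_right (hx.2.trans hc.2).le)) (fun y hy =>
      (hU.differentiableAt ⟨hy.1, hy.2.trans (hx.2.trans hc.2)⟩).differentiableWithinAt)
  obtain ⟨y, hy, hy1⟩ := exists_deriv_eq_slope f hx.2
    (hU.continuousOn.mono (Icc_subset_Icc hx.1.le hc.2.le)) (fun y hy =>
      (hU.differentiableAt ⟨hx.1.trans hy.1, hy.2.trans hc.2⟩).differentiableWithinAt)
  have hz2 : deriv f z ≤ 1 := by
    rw [hz1, hU.map_zero, div_le_one (by linarith [hx.1])]; linarith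
  have hy2 : 1 ≤ deriv f y := by
    rw [hy1, le_div_iff₀ (by linarith [hx.2])]; linarith
  have hsub : Ioo 0 y ⊆ Ioo (0 : ℝ) 1 := Ioo_subset_Ioo_right (hy.2.trans hc.2).le
  have hy01 : y ∈ Ioo (0 : ℝ) 1 := ⟨hx.1.trans hy.1, hy.2.trans hc.2⟩
  have := min_lt_of_negSchwarzian (h := f) (u := derivWithin f (Icc 0 1)) (a := 0) (b := y) (z := z)
    ((hU.smooth.continuousOn_derivWithin (uniqueDiffOn_Icc one_pos) (by simp)).mono
      (Icc_subset_Icc_right hy01.2.le))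
    (fun t ht => derivWithin_Icc (hsub ht))
    (fun t ht => hf.negSchwarzianAt (hsub ht) (ht.2.trans hy.2).ne)
    (fun t ht => by rw [derivWithin_Icc (hsub ht)]; exact hU.deriv_pos ⟨ht.1, ht.2.trans hy.2⟩)
    ⟨hz.1, hz.2.trans hy.1⟩
  rw [derivWithin_Icc hy01, derivWithin_Icc (hsub ⟨hz.1, hz.2.trans hy.1⟩)] at this
  have h1 := hf.one_le_deriv_zero
  have := (le_min h1 hy2).trans_lt this
  linarith

end IsSUnimodal

open Function

/-! ### Periodic points of unimodal maps -/

theorem iterate_ne_zero_of_isPeriodicPt {f : ℝ → ℝ} (h0 : f 0 = 0) {n : ℕ} (hn : 0 < n) {x : ℝ}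
    (hp : IsPeriodicPt f n x) (hx : x ≠ 0) (k : ℕ) : f^[k] x ≠ 0 := by
  intro hk
  have h1 : f^[n * k] x = x := hp.mul_const k
  have h2 : f^[n * k] x = f^[n * k - k] (f^[k] x) := by
    rw [← iterate_add_apply, Nat.sub_add_cancel (Nat.le_mul_of_pos_left k hn)]
  rw [h2, hk, iterate_fixed h0] at h1
  exact hx h1.symm

namespace IsSUnimodal

variable {f : ℝ → ℝ} {c : ℝ}

theorem le_map_crit_of_isPeriodicPt (hf : IsSUnimodal f c) {n : ℕ} (hn : 0 < n) {x : ℝ}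
    (hx : x ∈ Icc (0 : ℝ) 1) (hp : IsPeriodicPt f n x) : x ≤ f c := by
  have h1 : f (f^[n - 1] x) = x := by
    rw [← iterate_succ_apply' f, Nat.succ_eq_add_one, Nat.sub_add_cancel hn]; exact hp
  rw [← h1]
  exact hf.toIsUnimodal.le_map_crit (hf.mapsTo.iterate _ hx)

/-- Apart from the fixed point `0`, the periodic points lie between the first two images of the
critical point: the least point of a periodic orbit is the image of a point `y` of the orbit, and
`y < c` is impossible, as then `f y > y`. -/
theorem mem_Icc_of_isPeriodicPt (hf : IsSUnimodal f c) (hc1 : c ≤ f c) {n : ℕ} (hn : 0 < n) {x : ℝ}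
    (hx : x ∈ Icc (0 : ℝ) 1) (hp : IsPeriodicPt f n x) (h0 : x ≠ 0) :
    x ∈ Icc (f (f c)) (f c) := by
  refine ⟨?_, hf.le_map_crit_of_isPeriodicPt hn hx hp⟩
  obtain ⟨i, hi, hmin⟩ := Finset.exists_min_image (Finset.range n) (fun i => f^[i] x)
    ⟨0, Finset.mem_range.2 hn⟩
  have hmin' : ∀ k, f^[i] x ≤ f^[k] x := fun k => by
    rw [← hp.iterate_mod_apply k]
    exact hmin _ (Finset.mem_range.2 (Nat.mod_lt _ hn))
  set y := f^[i + n - 1] x with hy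
  have hfy : f y = f^[i] x := by
    rw [hy, ← iterate_succ_apply' f, show (i + n - 1).succ = i + n by omega, iterate_add_apply]
    exact congrArg _ hp
  have hyI : y ∈ Icc (0 : ℝ) 1 := hf.mapsTo.iterate _ hx
  have hy0 : 0 < y := lt_of_le_of_ne hyI.1
    (iterate_ne_zero_of_isPeriodicPt hf.map_zero hn hp h0 _).symm
  have hyc : c ≤ y := by
    by_contra! hlt
    have h1 := hf.lt_map hc1 ⟨hy0, hlt⟩
    have h2 := hmin' (i + n - 1)
    rw [hfy] at h1
    exact absurd (h1.trans_le h2) (lt_irrefl _)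
  have hyf : y ≤ f c := hf.le_map_crit_of_isPeriodicPt hn hyI (hp.apply_iterate _)
  calc f (f c) ≤ f y := hf.toIsUnimodal.strictAntiOn.antitoneOn ⟨hyc, hyI.2⟩
          ⟨hc1, (hf.mapsTo hf.toIsUnimodal.crit_mem_Icc).2⟩ hyf
    _ ≤ x := by rw [hfy]; exact hmin' 0

/-- If the critical point is fixed, all periodic points are fixed. -/
theorem isFixedPt_of_isPeriodicPt (hf : IsSUnimodal f c) (hc1 : f c = c) {n : ℕ} (hn : 0 < n)
    {x : ℝ} (hx : x ∈ Icc (0 : ℝ) 1) (hp : IsPeriodicPt f n x) : f x = x := by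
  by_cases h0 : x = 0
  · rw [h0, hf.map_zero]
  · have h := hf.mem_Icc_of_isPeriodicPt hc1.ge hn hx hp h0
    rw [hc1, hc1, Icc_self, mem_singleton_iff] at h
    rw [h, hc1]

theorem exists_fixed (hf : IsSUnimodal f c) (hc1 : c < f c) :
    ∃ p ∈ Ioo c 1, f p = p ∧ p < f c := by
  have hU := hf.toIsUnimodal
  have hc := hU.crit_mem
  have hcont : ContinuousOn (fun x => f x - x) (Icc c 1) :=
    (hU.continuousOn.mono (Icc_subset_Icc_left hc.1.le)).sub continuousOn_id
  obtain ⟨p, hp, hp0⟩ := intermediate_value_Icc' hc.2.le hcont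
    (show (0 : ℝ) ∈ Icc (f 1 - 1) (f c - c) by
      rw [hU.map_one]; constructor <;> linarith)
  have hfp : f p = p := by linarith [hp0]
  have hpc : p ≠ c := by rintro rfl; linarith
  have hp1 : p ≠ 1 := by rintro rfl; rw [hU.map_one] at hfp; linarith
  have hcp : c < p := lt_of_le_of_ne hp.1 hpc.symm
  refine ⟨p, ⟨hcp, lt_of_le_of_ne hp.2 hp1⟩, hfp, ?_⟩
  calc p = f p := hfp.symm
    _ < f c := hU.strictAntiOn ⟨le_rfl, hc.2.le⟩ hp hcp

theorem eq_of_fixed (hf : IsSUnimodal f c) {x p : ℝ} (hx : x ∈ Icc c 1) (hp : p ∈ Icc c 1)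
    (hfx : f x = x) (hfp : f p = p) : x = p := by
  rcases lt_trichotomy x p with h | h | h
  · have := hf.toIsUnimodal.strictAntiOn hx hp h; linarith
  · exact h
  · have := hf.toIsUnimodal.strictAntiOn hp hx h; linarith

/-- To the right of `c`, as long as the image stays there, `f ∘ f` is increasing with negative
Schwarzian derivative. -/
theorem comp_self (hf : IsSUnimodal f c) {x : ℝ} (hx : x ∈ Ioo c 1) (hfx : f x ∈ Ioo c 1) :
    NegSchwarzianAt (f ∘ f) x ∧ 0 < deriv (f ∘ f) x := by
  have hU := hf.toIsUnimodal
  have hc := hU.crit_mem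
  have hx1 : x ∈ Ioo (0 : ℝ) 1 := ⟨hc.1.trans hx.1, hx.2⟩
  have hfx1 : f x ∈ Ioo (0 : ℝ) 1 := ⟨hc.1.trans hfx.1, hfx.2⟩
  refine ⟨(hf.negSchwarzianAt hfx1 hfx.1.ne').comp (hf.negSchwarzianAt hx1 hx.1.ne'), ?_⟩
  rw [deriv_comp x (hU.differentiableAt hfx1) (hU.differentiableAt hx1)]
  exact mul_pos_of_neg_of_neg (hU.deriv_neg hfx) (hU.deriv_neg hx)

end IsSUnimodal

/-! ### Period two -/

/-- The number of fixed points of the `n`-th iterate if there are, besides the fixed point `0`,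
exactly one periodic orbit of each of the periods `2 ^ m`, `m ≤ j`. -/
def cascadeCount (j n : ℕ) : ℕ := 1 + ∑ m ∈ Finset.range (j + 1), if 2 ^ m ∣ n then 2 ^ m else 0

theorem cascadeCount_of_odd (j : ℕ) {n : ℕ} (hn : Odd n) : cascadeCount j n = 2 := by
  have : ∀ m, ¬ 2 ^ (m + 1) ∣ n := fun m h =>
    Nat.not_even_iff_odd.2 hn (even_iff_two_dvd.2 ((dvd_pow_self 2 m.succ_ne_zero).trans h))
  simp [cascadeCount, Finset.sum_range_succ', this]

theorem cascadeCount_succ_two_mul (j n : ℕ) :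
    cascadeCount (j + 1) (2 * n) = 2 * cascadeCount j n := by
  have : ∀ m, 2 ^ (m + 1) ∣ 2 * n ↔ 2 ^ m ∣ n := fun m => by
    rw [pow_succ', Nat.mul_dvd_mul_iff_left two_pos]
  simp only [cascadeCount, Finset.sum_range_succ' _ (j + 1), this, mul_add, Finset.mul_sum, mul_ite,
    mul_zero, pow_zero, one_dvd, if_true]
  simp only [pow_succ']
  ring

theorem map_eq_of_iterate_eq {h : ℝ → ℝ} {s : Set ℝ} (hmono : MonotoneOn h s) (hmaps : MapsTo h s s)
    {n : ℕ} (hn : 0 < n) {x : ℝ} (hx : x ∈ s) (hp : h^[n] x = x) : h x = x := by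
  obtain ⟨k, rfl⟩ : ∃ k, n = k + 1 := ⟨n - 1, by omega⟩
  rcases lt_trichotomy (h x) x with hlt | heq | hgt
  · have : ∀ k, h^[k + 1] x < x := fun k => by
      induction k with
      | zero => exact hlt
      | succ k ih =>
        rw [iterate_succ_apply']
        exact (hmono (hmaps.iterate _ hx) hx ih.le).trans_lt hlt
    exact absurd hp (this k).ne
  · exact heq
  · have : ∀ k, x < h^[k + 1] x := fun k => by
      induction k with
      | zero => exact hgt
      | succ k ih =>
        rw [iterate_succ_apply']
        exact hgt.trans_le (hmono hx (hmaps.iterate _ hx) ih.le)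
    exact absurd hp (this k).ne'

theorem isPeriodicPt_one_of_odd {f : ℝ → ℝ} {n : ℕ} (hn : Odd n) {x : ℝ} (h2 : IsPeriodicPt f 2 x)
    (h : IsPeriodicPt f n x) : f x = x := by
  have := h2.gcd h
  rwa [(Nat.coprime_two_left.2 hn).gcd_eq_one] at this

/-- If the critical orbit stays to the right of `c` and there is an orbit of period two, then the
periodic points are the two fixed points and this orbit. -/
theorem IsSUnimodal.ncard_per_of_period_two {f : ℝ → ℝ} {c : ℝ} (hf : IsSUnimodal f c)
    (hc1 : c < f c) (hc2 : c ≤ f (f c)) {a : ℝ} (ha : a ∈ Icc (0 : ℝ) 1)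
    (hper : minimalPeriod f a = 2) {n : ℕ} (hn : 0 < n) :
    (per f n).Finite ∧ (per f n).ncard = cascadeCount 1 n := by
  have hU := hf.toIsUnimodal
  have hc := hU.crit_mem
  obtain ⟨p, hp, hfp, hpc1⟩ := hf.exists_fixed hc1
  have hfc1 : f c < 1 := by
    refine lt_of_le_of_ne (hU.mapsTo hU.crit_mem_Icc).2 (fun h => ?_)
    rw [h, hU.map_one] at hc2
    linarith [hc.1]
  have hI : ∀ x ∈ Icc c (f c), x ∈ Icc c 1 := fun x hx => ⟨hx.1, hx.2.trans hfc1.le⟩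
  have hI0 : ∀ x ∈ Icc c (f c), x ∈ Icc (0 : ℝ) 1 := fun x hx =>
    ⟨hc.1.le.trans hx.1, hx.2.trans hfc1.le⟩
  have hmaps : MapsTo f (Icc c (f c)) (Icc c (f c)) := fun x hx =>
    ⟨hc2.trans (hU.strictAntiOn.antitoneOn (hI x hx) ⟨hc1.le, hfc1.le⟩ hx.2),
      hU.le_map_crit (hI0 x hx)⟩
  have hmono : MonotoneOn (f ∘ f) (Icc c (f c)) := fun x hx y hy hxy =>
    hU.strictAntiOn.antitoneOn (hI _ (hmaps hy)) (hI _ (hmaps hx))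
      (hU.strictAntiOn.antitoneOn (hI _ hx) (hI _ hy) hxy)
  have hmem : ∀ {m : ℕ} {x : ℝ}, 0 < m → x ∈ Icc (0 : ℝ) 1 → IsPeriodicPt f m x → x ≠ 0 →
      x ∈ Icc c (f c) := fun hm hx hpx h0 => by
    have := hf.mem_Icc_of_isPeriodicPt hc1.le hm hx hpx h0
    exact ⟨hc2.trans this.1, this.2⟩
  have hfix0 : ∀ m, IsPeriodicPt f m 0 := fun m => iterate_fixed hU.map_zero m
  have hfixp : ∀ m, IsPeriodicPt f m p := fun m => iterate_fixed hfp m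
  have hpI : p ∈ Icc c (f c) := ⟨hp.1.le, hpc1.le⟩
  have htwo : ∀ {m : ℕ} {x : ℝ}, 0 < m → x ∈ Icc c (f c) → IsPeriodicPt f m x → f (f x) = x := by
    intro m x hm hx hpx
    refine map_eq_of_iterate_eq (h := f ∘ f) hmono (hmaps.comp hmaps) hm hx ?_
    have : f^[2 * m] x = x := hpx.const_mul 2
    rwa [iterate_mul] at this
  have hp0 : (0 : ℝ) ≠ p := (hc.1.trans hp.1).ne
  rcases Nat.even_or_odd n with hev | hodd
  · have ha2 : f (f a) = a := by
      have := isPeriodicPt_minimalPeriod f a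
      rwa [hper] at this
    have hfa : f a ≠ a := fun h => by
      rw [minimalPeriod_eq_one_iff_isFixedPt.2 h] at hper
      omega
    have ha0 : a ≠ 0 := by rintro rfl; exact hfa hU.map_zero
    have haI := hmem two_pos ha (show IsPeriodicPt f 2 a from ha2) ha0
    -- the smaller of the two points of the orbit
    obtain ⟨b, hbI, hb2, hbp, hset⟩ : ∃ b ∈ Icc c (f c), f (f b) = b ∧ b < p ∧
        ({b, f b} : Set ℝ) = {a, f a} := by
      rcases lt_trichotomy a p with h | h | h
      · exact ⟨a, haI, ha2, h, rfl⟩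
      · exact absurd (h ▸ hfp) hfa
      · refine ⟨f a, hmaps haI, by rw [ha2], ?_, by rw [ha2, Set.pair_comm]⟩
        rw [← hfp]
        exact hU.strictAntiOn (hI _ hpI) (hI _ haI) h
    have hpb : p < f b := by
      conv_lhs => rw [← hfp]
      exact hU.strictAntiOn (hI _ hbI) (hI _ hpI) hbp
    have hb0 : 0 < b := hc.1.trans_le hbI.1
    have hper_eq : per f n = {0, p, b, f b} := by
      ext x
      simp only [per, mem_ofPred_eq, mem_insert_iff, mem_singleton_iff]
      constructor
      · rintro ⟨hx, hpx⟩
        by_contra! hne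
        have hxI := hmem hn hx hpx hne.1
        have hx2 := htwo hn hxI hpx
        have hfbI := hmaps hbI
        have hfour : ∀ u v w t, u ∈ Icc c (f c) → t ∈ Icc c (f c) → u < v → v < w → w < t →
            f (f u) = u → f (f v) = v → f (f w) = w → f (f t) = t → False := by
          intro u v w t hu ht huv hvw hwt h1 h2 h3 h4
          have hsub : ∀ y ∈ Ioo u t, y ∈ Ioo c 1 ∧ f y ∈ Ioo c 1 := fun y hy => by
            have hy1 : c < y := hu.1.trans_lt hy.1
            have hy2 : y < f c := hy.2.trans_le ht.2
            refine ⟨⟨hy1, hy2.trans hfc1⟩,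
              hc2.trans_lt (hU.strictAntiOn ⟨hy1.le, (hy2.trans hfc1).le⟩
              ⟨hc1.le, hfc1.le⟩ hy2), (hU.le_map_crit ?_).trans_lt hfc1⟩
            exact hI0 y ⟨hy1.le, hy2.le⟩
          have hcont : ContinuousOn (f ∘ f) (Icc u t) :=
            hU.continuousOn.comp (hU.continuousOn.mono fun y hy =>
              hI0 y ⟨hu.1.trans hy.1, hy.2.trans ht.2⟩)
              (fun y hy => hU.mapsTo (hI0 y ⟨hu.1.trans hy.1, hy.2.trans ht.2⟩))
          exact not_four_fixed huv hvw hwt hcont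
            (fun y hy => (hf.comp_self (hsub y hy).1 (hsub y hy).2).1)
            (fun y hy => (hf.comp_self (hsub y hy).1 (hsub y hy).2).2) h1 h2 h3 h4
        have hpp : f (f p) = p := by rw [hfp, hfp]
        have hfb2 : f (f (f b)) = f b := by rw [hb2]
        rcases lt_or_gt_of_ne hne.2.1 with hxp | hxp
        · rcases lt_or_gt_of_ne hne.2.2.1 with hxb | hxb
          · exact hfour x b p (f b) hxI hfbI hxb hbp hpb hx2 hb2 hpp hfb2
          · exact hfour b x p (f b) hbI hfbI hxb hxp hpb hb2 hx2 hpp hfb2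
        · rcases lt_or_gt_of_ne hne.2.2.2 with hxb | hxb
          · exact hfour b p x (f b) hbI hfbI hbp hxp hxb hb2 hpp hx2 hfb2
          · exact hfour b p (f b) x hbI hxI hbp hpb hxb hb2 hpp hfb2 hx2
      · obtain ⟨m, rfl⟩ := hev.two_dvd
        have hb' : IsPeriodicPt f 2 b := hb2
        rintro (rfl | rfl | rfl | rfl)
        · exact ⟨⟨le_rfl, zero_le_one⟩, hfix0 _⟩
        · exact ⟨hI0 _ hpI, hfixp _⟩
        · exact ⟨hI0 _ hbI, hb'.mul_const m⟩
        · exact ⟨hI0 _ (hmaps hbI), (hb'.mul_const m).apply⟩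
    rw [hper_eq]
    refine ⟨by simp, ?_⟩
    rw [Set.ncard_insert_of_notMem (by
        simp only [mem_insert_iff, mem_singleton_iff, not_or]
        exact ⟨hp0, hb0.ne, ((hb0.trans hbp).trans hpb).ne⟩),
      Set.ncard_insert_of_notMem (by
        simp only [mem_insert_iff, mem_singleton_iff, not_or]; exact ⟨hbp.ne', hpb.ne⟩),
      Set.ncard_pair (hbp.trans hpb).ne]
    simp [cascadeCount, Finset.sum_range_succ, hev.two_dvd]
  · have hper_eq : per f n = {0, p} := by
      ext x
      simp only [per, mem_ofPred_eq, mem_insert_iff, mem_singleton_iff]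
      constructor
      · rintro ⟨hx, hpx⟩
        by_cases h0 : x = 0
        · exact Or.inl h0
        have hxI := hmem hn hx hpx h0
        exact Or.inr (hf.eq_of_fixed (hI _ hxI) (hI _ hpI)
          (isPeriodicPt_one_of_odd hodd (htwo hn hxI hpx) hpx) hfp)
      · rintro (rfl | rfl)
        · exact ⟨⟨le_rfl, zero_le_one⟩, hfix0 _⟩
        · exact ⟨hI0 _ hpI, hfixp _⟩
    rw [hper_eq]
    refine ⟨by simp, ?_⟩
    rw [Set.ncard_pair hp0, cascadeCount_of_odd 1 hodd]

/-! ### Renormalization -/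

/-- The map `f` with critical point `c` can be renormalized: `p` is the fixed point to the right
of `c`, `q` the other preimage of `p`, and `f ∘ f` maps the interval `[q, p]` into itself. -/
structure Renormalizable (f : ℝ → ℝ) (c p q : ℝ) : Prop where
  isSUnimodal : IsSUnimodal f c
  fixed_mem : p ∈ Ioo c 1
  map_fixed : f p = p
  fixed_lt : p < f c
  preimage_mem : q ∈ Ioo 0 c
  map_preimage : f q = p
  le_map_map_crit : q ≤ f (f c)
  map_map_crit_le : f (f c) ≤ c

/-- The affine map that takes `[0, 1]` to the interval with endpoints `p`, `q`. -/
def chart (p q t : ℝ) : ℝ := p + (q - p) * t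

/-- The inverse of `chart p q`. -/
noncomputable def chartInv (p q y : ℝ) : ℝ := -p / (q - p) + (q - p)⁻¹ * y

/-- The renormalization of `f`: the map `f ∘ f` on `[q, p]`, rescaled to `[0, 1]` with reversed
orientation, so that the fixed point `p` becomes `0`. -/
noncomputable def renorm (f : ℝ → ℝ) (p q : ℝ) : ℝ → ℝ := chartInv p q ∘ (f ∘ f) ∘ chart p q

theorem chart_chartInv {p q : ℝ} (h : q < p) (y : ℝ) : chart p q (chartInv p q y) = y := by
  have : q - p ≠ 0 := by linarith
  unfold chart chartInv
  field_simp
  ring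

theorem chartInv_chart {p q : ℝ} (h : q < p) (t : ℝ) : chartInv p q (chart p q t) = t := by
  have : q - p ≠ 0 := by linarith
  unfold chart chartInv
  field_simp
  ring

theorem chart_lt_chart {p q : ℝ} (h : q < p) {s t : ℝ} : chart p q s < chart p q t ↔ t < s := by
  unfold chart
  rw [add_lt_add_iff_left, mul_lt_mul_left_of_neg (by linarith)]

theorem chart_le_chart {p q : ℝ} (h : q < p) {s t : ℝ} : chart p q s ≤ chart p q t ↔ t ≤ s := by
  rw [← not_lt, chart_lt_chart h, not_lt]

theorem chart_zero (p q : ℝ) : chart p q 0 = p := by simp [chart]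

theorem chart_one (p q : ℝ) : chart p q 1 = q := by simp [chart]

theorem chart_mem_Icc {p q : ℝ} (h : q < p) {t : ℝ} :
    chart p q t ∈ Icc q p ↔ t ∈ Icc (0 : ℝ) 1 := by
  have h0 := chart_le_chart h (s := t) (t := 0)
  have h1 := chart_le_chart h (s := 1) (t := t)
  rw [chart_zero] at h0
  rw [chart_one] at h1
  rw [mem_Icc, mem_Icc, h0, h1, and_comm]

theorem chart_injective {p q : ℝ} (h : q < p) : Injective (chart p q) :=
  Function.LeftInverse.injective (chartInv_chart h)

namespace Renormalizable

variable {f : ℝ → ℝ} {c p q : ℝ}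

theorem lt (hr : Renormalizable f c p q) : q < p := hr.preimage_mem.2.trans hr.fixed_mem.1

theorem map_crit_lt_one (hr : Renormalizable f c p q) : f c < 1 := by
  have hU := hr.isSUnimodal.toIsUnimodal
  refine lt_of_le_of_ne (hU.mapsTo hU.crit_mem_Icc).2 (fun h => ?_)
  have := hr.le_map_map_crit
  rw [h, hU.map_one] at this
  linarith [hr.preimage_mem.1]

theorem mem_Ioo_of_mem (hr : Renormalizable f c p q) {x : ℝ} (hx : x ∈ Icc q p) :
    x ∈ Ioo (0 : ℝ) 1 :=
  ⟨hr.preimage_mem.1.trans_le hx.1, hx.2.trans_lt hr.fixed_mem.2⟩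

theorem mapsTo_right (hr : Renormalizable f c p q) : MapsTo f (Icc q p) (Icc p (f c)) := by
  intro x hx
  have hU := hr.isSUnimodal.toIsUnimodal
  have hx1 := hr.mem_Ioo_of_mem hx
  refine ⟨?_, hU.le_map_crit (Ioo_subset_Icc_self hx1)⟩
  rcases le_total x c with h | h
  · rw [← hr.map_preimage]
    exact hU.strictMonoOn.monotoneOn ⟨hr.preimage_mem.1.le, hr.preimage_mem.2.le⟩ ⟨hx1.1.le, h⟩ hx.1
  · conv_lhs => rw [← hr.map_fixed]
    exact hU.strictAntiOn.antitoneOn ⟨h, hx1.2.le⟩ ⟨hr.fixed_mem.1.le, hr.fixed_mem.2.le⟩ hx.2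

theorem mem_Ioo_of_mem_right (hr : Renormalizable f c p q) {x : ℝ} (hx : x ∈ Icc p (f c)) :
    x ∈ Ioo c 1 :=
  ⟨hr.fixed_mem.1.trans_le hx.1, hx.2.trans_lt hr.map_crit_lt_one⟩

theorem mapsTo_left (hr : Renormalizable f c p q) : MapsTo f (Icc p (f c)) (Icc q p) := by
  intro x hx
  have hU := hr.isSUnimodal.toIsUnimodal
  have hx1 := hr.mem_Ioo_of_mem_right hx
  have hfc : f c ∈ Ioo c 1 := hr.mem_Ioo_of_mem_right ⟨hr.fixed_lt.le, le_rfl⟩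
  refine ⟨hr.le_map_map_crit.trans (hU.strictAntiOn.antitoneOn (Ioo_subset_Icc_self hx1)
    (Ioo_subset_Icc_self hfc) hx.2), ?_⟩
  conv_rhs => rw [← hr.map_fixed]
  exact hU.strictAntiOn.antitoneOn (Ioo_subset_Icc_self hr.fixed_mem) (Ioo_subset_Icc_self hx1) hx.1

theorem mapsTo_comp (hr : Renormalizable f c p q) : MapsTo (f ∘ f) (Icc q p) (Icc q p) :=
  hr.mapsTo_left.comp hr.mapsTo_right

/-- The fixed point `p` is not strictly attracting. On either side of `p` the mean value theorem
gives a point where `f ∘ f` has derivative `≥ 1`, so the minimum principle applies. -/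
theorem one_le_deriv_sq (hr : Renormalizable f c p q) : 1 ≤ deriv f p ^ 2 := by
  have hf := hr.isSUnimodal
  have hU := hf.toIsUnimodal
  have hc := hU.crit_mem
  have hfc1 := hr.map_crit_lt_one
  have hcfc : c < f c := hr.fixed_mem.1.trans hr.fixed_lt
  -- the preimage `c'` of `c` to the right of `p`
  obtain ⟨c', hc', hfc'⟩ := intermediate_value_Icc' hr.fixed_lt.le
    (hU.continuousOn.mono (Icc_subset_Icc (hc.1.le.trans hr.fixed_mem.1.le) hfc1.le))
    (show c ∈ Icc (f (f c)) (f p) from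
      ⟨hr.map_map_crit_le, by rw [hr.map_fixed]; exact hr.fixed_mem.1.le⟩)
  have hpc' : p < c' := by
    refine lt_of_le_of_ne hc'.1 ?_
    rintro rfl
    rw [hr.map_fixed] at hfc'
    exact hr.fixed_mem.1.ne' hfc'
  have hsub : ∀ x ∈ Ioo c c', x ∈ Ioo c 1 ∧ f x ∈ Ioo c 1 := fun x hx => by
    have hx1 : x < 1 := hx.2.trans_le (hc'.2.trans hfc1.le)
    refine ⟨⟨hx.1, hx1⟩, ?_, ?_⟩
    · conv_lhs => rw [← hfc']
      exact hU.strictAntiOn ⟨hx.1.le, hx1.le⟩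
        ⟨hr.fixed_mem.1.le.trans hc'.1, hc'.2.trans hfc1.le⟩ hx.2
    · exact (hU.le_map_crit ⟨(hc.1.trans hx.1).le, hx1.le⟩).trans_lt hfc1
  have hS := fun x hx => hf.comp_self (hsub x hx).1 (hsub x hx).2
  have hcont : ContinuousOn (f ∘ f) (Icc c c') := by
    have hs : Icc c c' ⊆ Icc 0 1 := Icc_subset_Icc hc.1.le (hc'.2.trans hfc1.le)
    exact hU.continuousOn.comp (hU.continuousOn.mono hs) (fun y hy => hU.mapsTo (hs hy))
  have hmvt : ∀ u v, c ≤ u → u < v → v ≤ c' → v - u ≤ f (f v) - f (f u) →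
      ∃ y ∈ Ioo u v, 1 ≤ deriv (f ∘ f) y := by
    intro u v hu huv hv hle
    obtain ⟨y, hy, hy1⟩ := exists_deriv_eq_slope (f ∘ f) huv
      (hcont.mono (Icc_subset_Icc hu hv)) (fun y hy =>
        ((hS y ⟨hu.trans_lt hy.1, hy.2.trans_le hv⟩).1.contDiffAt.differentiableAt
          (by simp)).differentiableWithinAt)
    refine ⟨y, hy, ?_⟩
    rw [hy1, le_div_iff₀ (by linarith), one_mul]
    exact hle
  have hffp : f (f p) = p := by rw [hr.map_fixed, hr.map_fixed]
  obtain ⟨y₁, h₁, e₁⟩ := hmvt c p le_rfl hr.fixed_mem.1 hc'.1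
    (by rw [hffp]; linarith [hr.map_map_crit_le])
  obtain ⟨y₂, h₂, e₂⟩ := hmvt p c' hr.fixed_mem.1.le hpc' le_rfl
    (by rw [hffp, hfc']; linarith [hc'.2])
  have hsub' : Icc y₁ y₂ ⊆ Ioo c c' := fun x hx => ⟨h₁.1.trans_le hx.1, hx.2.trans_lt h₂.2⟩
  have := min_lt_of_negSchwarzian (h := f ∘ f) (u := deriv (f ∘ f)) (a := y₁) (b := y₂) (z := p)
    (fun x hx => (contDiffAt_deriv (m := 2) (n := 3) (hS x (hsub' hx)).1.contDiffAt
      le_rfl).continuousAt.continuousWithinAt) (fun _ _ => rfl)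
    (fun x hx => (hS x (hsub' (Ioo_subset_Icc_self hx))).1)
    (fun x hx => (hS x (hsub' (Ioo_subset_Icc_self hx))).2)
    ⟨h₁.2, h₂.1⟩
  have hp01 : p ∈ Ioo (0 : ℝ) 1 := ⟨hc.1.trans hr.fixed_mem.1, hr.fixed_mem.2⟩
  rw [deriv_comp p (by rw [hr.map_fixed]; exact hU.differentiableAt hp01)
    (hU.differentiableAt hp01), hr.map_fixed, ← sq] at this
  exact (le_min e₁ e₂).trans this.le

theorem hasDerivAt_renorm (hr : Renormalizable f c p q) {t : ℝ} (ht : t ∈ Icc (0 : ℝ) 1) :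
    HasDerivAt (renorm f p q) (deriv f (f (chart p q t)) * deriv f (chart p q t)) t := by
  have hU := hr.isSUnimodal.toIsUnimodal
  have hx := (chart_mem_Icc hr.lt).2 ht
  have hfx := hr.mem_Ioo_of_mem_right (hr.mapsTo_right hx)
  have h1 := (hU.differentiableAt (hr.mem_Ioo_of_mem hx)).hasDerivAt
  have h2 := (hU.differentiableAt ⟨hU.crit_mem.1.trans hfx.1, hfx.2⟩).hasDerivAt
  have h3 : HasDerivAt (chart p q) (q - p) t := hasDerivAt_affine p (q - p) t
  have h4 : HasDerivAt (chartInv p q) (q - p)⁻¹ (f (f (chart p q t))) := hasDerivAt_affine _ _ _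
  have hne : q - p ≠ 0 := by linarith [hr.lt]
  refine (h4.comp t ((h2.comp _ h1).comp t h3)).congr_deriv ?_
  field_simp

/-- The renormalization of `f` is again unimodal with negative Schwarzian derivative. -/
theorem isSUnimodal_renorm (hr : Renormalizable f c p q) :
    IsSUnimodal (renorm f p q) (chartInv p q c) := by
  have hf := hr.isSUnimodal
  have hU := hf.toIsUnimodal
  have hlt := hr.lt
  have hne : q - p ≠ 0 := by linarith
  have hchart : chart p q (chartInv p q c) = c := chart_chartInv hlt c
  have hmapsC : MapsTo (chart p q) (Icc 0 1) (Icc q p) := fun t ht => (chart_mem_Icc hlt).2 ht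
  have hJ : Icc q p ⊆ Icc 0 1 := fun x hx => Ioo_subset_Icc_self (hr.mem_Ioo_of_mem hx)
  have hcrit : chartInv p q c ∈ Ioo (0 : ℝ) 1 := by
    rw [mem_Ioo, ← chart_lt_chart hlt, ← chart_lt_chart hlt (t := chartInv p q c), hchart,
      chart_zero, chart_one]
    exact ⟨hr.fixed_mem.1, hr.preimage_mem.2⟩
  have hdw : ∀ t ∈ Icc (0 : ℝ) 1, derivWithin (renorm f p q) (Icc 0 1) t
      = deriv f (f (chart p q t)) * deriv f (chart p q t) := fun t ht =>
    (hr.hasDerivAt_renorm ht).hasDerivWithinAt.derivWithin (uniqueDiffOn_Icc one_pos t ht)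
  have hrenorm0 : ∀ t, f (f (chart p q t)) = p → renorm f p q t = 0 := fun t h => by
    have h0 := chartInv_chart hlt 0
    rw [chart_zero] at h0
    simp only [renorm, Function.comp, h, h0]
  have hSR : ∀ t ∈ Ioo (0 : ℝ) 1, t ≠ chartInv p q c → NegSchwarzianAt (renorm f p q) t := by
    intro t ht htc
    have hx := hmapsC (Ioo_subset_Icc_self ht)
    have hxc : chart p q t ≠ c := fun h => htc (chart_injective hlt (h.trans hchart.symm))
    have hfx := hr.mem_Ioo_of_mem_right (hr.mapsTo_right hx)
    have h1 := hf.negSchwarzianAt (hr.mem_Ioo_of_mem hx) hxc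
    have h2 := hf.negSchwarzianAt ⟨hU.crit_mem.1.trans hfx.1, hfx.2⟩ hfx.1.ne'
    have h3 : NegSchwarzianAt ((f ∘ f) ∘ fun t => p + (q - p) * t) t :=
      (h2.comp h1).comp_affine hne
    exact h3.affine_comp (a := -p / (q - p)) (inv_ne_zero hne)
  refine { mapsTo := ?_, smooth := ?_, crit_mem := hcrit, crit_iff := ?_, map_zero := ?_,
           map_one := ?_, schwarzian_neg := ?_, one_le_deriv_zero := ?_ }
  · intro t ht
    rw [← chart_mem_Icc hlt]
    simp only [renorm, Function.comp, chart_chartInv hlt]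
    exact hr.mapsTo_comp (hmapsC ht)
  · have h1 : ContDiffOn ℝ 3 (chart p q) (Icc 0 1) := by unfold chart; fun_prop
    have h2 : ContDiff ℝ 3 (chartInv p q) := by unfold chartInv; fun_prop
    have h3 : ContDiffOn ℝ 3 (f ∘ f) (Icc q p) :=
      hU.smooth.comp (hU.smooth.mono hJ) (fun x hx => hU.mapsTo (hJ hx))
    exact h2.comp_contDiffOn (h3.comp h1 hmapsC)
  · intro t ht
    have hx := hmapsC ht
    have hfx := hr.mem_Ioo_of_mem_right (hr.mapsTo_right hx)
    have h1 := (hU.deriv_neg hfx).ne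
    rw [hdw t ht, mul_eq_zero, or_iff_right h1, hU.deriv_eq_zero_iff (hr.mem_Ioo_of_mem hx)]
    constructor
    · intro h; exact chart_injective hlt (h.trans hchart.symm)
    · rintro rfl; exact hchart
  · exact hrenorm0 0 (by rw [chart_zero, hr.map_fixed, hr.map_fixed])
  · exact hrenorm0 1 (by rw [chart_one, hr.map_preimage, hr.map_fixed])
  · intro t ht htc
    exact (schwarzian_neg_iff ht (hSR t ht htc).deriv_ne_zero).2 (hSR t ht htc).num_neg
  · rw [hdw 0 ⟨le_rfl, zero_le_one⟩, chart_zero, hr.map_fixed, ← sq]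
    exact hr.one_le_deriv_sq

theorem chart_iterate_renorm (hr : Renormalizable f c p q) (n : ℕ) (t : ℝ) :
    chart p q ((renorm f p q)^[n] t) = f^[2 * n] (chart p q t) := by
  have hs : Semiconj (chart p q) (renorm f p q) (f^[2]) := fun t => by
    simp only [renorm, Function.comp, chart_chartInv hr.lt]; rfl
  rw [(hs.iterate_right n).eq t, iterate_mul]

theorem isPeriodicPt_renorm_iff (hr : Renormalizable f c p q) (n : ℕ) (t : ℝ) :
    IsPeriodicPt (renorm f p q) n t ↔ IsPeriodicPt f (2 * n) (chart p q t) := by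
  rw [IsPeriodicPt, IsFixedPt, IsPeriodicPt, IsFixedPt, ← hr.chart_iterate_renorm,
    (chart_injective hr.lt).eq_iff]

theorem mem_or_mem_of_isPeriodicPt (hr : Renormalizable f c p q) {n : ℕ} (hn : 0 < n) {x : ℝ}
    (hx : x ∈ Icc (0 : ℝ) 1) (hp : IsPeriodicPt f n x) (h0 : x ≠ 0) :
    x ∈ Icc q p ∨ x ∈ Icc p (f c) := by
  have h := hr.isSUnimodal.mem_Icc_of_isPeriodicPt (hr.fixed_mem.1.trans hr.fixed_lt).le hn hx hp h0
  rcases le_total x p with hxp | hxp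
  · exact Or.inl ⟨hr.le_map_map_crit.trans h.1, hxp⟩
  · exact Or.inr ⟨hxp, h.2⟩

theorem iterate_even_left (hr : Renormalizable f c p q) (k : ℕ) {x : ℝ} (hx : x ∈ Icc q p) :
    f^[2 * k] x ∈ Icc q p := by
  rw [iterate_mul]
  exact hr.mapsTo_comp.iterate k hx

/-- Iterates of odd order have two fixed points: `f` interchanges the intervals `[q, p]` and
`[p, f c]`, which have only the point `p` in common. -/
theorem ncard_per_odd (hr : Renormalizable f c p q) {n : ℕ} (hn : Odd n) :
    (per f n).Finite ∧ (per f n).ncard = 2 := by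
  have hU := hr.isSUnimodal.toIsUnimodal
  obtain ⟨k, rfl⟩ := hn
  have hper : per f (2 * k + 1) = {0, p} := by
    ext x
    simp only [per, mem_ofPred_eq, mem_insert_iff, mem_singleton_iff]
    constructor
    · rintro ⟨hx, hpx⟩
      by_cases h0 : x = 0
      · exact Or.inl h0
      refine Or.inr ?_
      rcases hr.mem_or_mem_of_isPeriodicPt (by omega) hx hpx h0 with h | h
      · have h1 := hr.mapsTo_right (hr.iterate_even_left k h)
        rw [← iterate_succ_apply' f, show f^[(2 * k).succ] x = x from hpx] at h1
        exact le_antisymm h.2 h1.1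
      · have h1 := hr.iterate_even_left k (hr.mapsTo_left h)
        rw [← iterate_succ_apply f, show f^[(2 * k).succ] x = x from hpx] at h1
        exact le_antisymm h1.2 h.1
    · rintro (rfl | rfl)
      · exact ⟨⟨le_rfl, zero_le_one⟩, iterate_fixed hU.map_zero _⟩
      · exact ⟨⟨(hU.crit_mem.1.trans hr.fixed_mem.1).le, hr.fixed_mem.2.le⟩,
          iterate_fixed hr.map_fixed _⟩
  rw [hper]
  exact ⟨by simp, Set.ncard_pair (hU.crit_mem.1.trans hr.fixed_mem.1).ne⟩

/-- Iterates of even order: the periodic points in `[q, p]` are those of the renormalization, `f`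
maps them bijectively to those in `[p, f c]`, and `p` is counted twice but `0` is not. -/
theorem ncard_per_even (hr : Renormalizable f c p q) {n : ℕ} (hn : 0 < n)
    (hfin : (per (renorm f p q) n).Finite) :
    (per f (2 * n)).Finite ∧ (per f (2 * n)).ncard = 2 * (per (renorm f p q) n).ncard := by
  have hU := hr.isSUnimodal.toIsUnimodal
  have hlt := hr.lt
  set L := {x ∈ Icc q p | IsPeriodicPt f (2 * n) x} with hL
  set R := {x ∈ Icc p (f c) | IsPeriodicPt f (2 * n) x} with hR
  have hLimg : L = chart p q '' per (renorm f p q) n := by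
    ext x
    simp only [hL, per, mem_image, mem_ofPred_eq]
    constructor
    · rintro ⟨hx, hpx⟩
      have hxx := chart_chartInv hlt x
      exact ⟨chartInv p q x, ⟨(chart_mem_Icc hlt).1 (by rwa [hxx]),
        (hr.isPeriodicPt_renorm_iff n _).2 (by rwa [hxx])⟩, hxx⟩
    · rintro ⟨t, ⟨ht, hpt⟩, rfl⟩
      exact ⟨(chart_mem_Icc hlt).2 ht, (hr.isPeriodicPt_renorm_iff n t).1 hpt⟩
  have hLfin : L.Finite := by rw [hLimg]; exact hfin.image _
  have hLcard : L.ncard = (per (renorm f p q) n).ncard := by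
    rw [hLimg, Set.ncard_image_of_injective _ (chart_injective hlt)]
  have hinj : ∀ s : Set ℝ, (∀ x ∈ s, IsPeriodicPt f (2 * n) x) → InjOn f s := by
    intro s hs x hx y hy hxy
    have h1 : f^[2 * n - 1] (f x) = x := by
      rw [← iterate_succ_apply f, Nat.succ_eq_add_one, Nat.sub_add_cancel (by omega)]
      exact hs x hx
    have h2 : f^[2 * n - 1] (f y) = y := by
      rw [← iterate_succ_apply f, Nat.succ_eq_add_one, Nat.sub_add_cancel (by omega)]
      exact hs y hy
    rw [← h1, hxy, h2]
  have hinjL : InjOn f L := hinj L fun x hx => hx.2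
  have hinjR : InjOn f R := hinj R fun x hx => hx.2
  have hLR : MapsTo f L R := fun x hx => ⟨hr.mapsTo_right hx.1, hx.2.apply⟩
  have hRL : MapsTo f R L := fun x hx => ⟨hr.mapsTo_left hx.1, hx.2.apply⟩
  have hRfin : R.Finite := Set.Finite.of_injOn hRL hinjR hLfin
  have hRcard : R.ncard = L.ncard := le_antisymm
    (Set.ncard_le_ncard_of_injOn f hRL hinjR hLfin) (Set.ncard_le_ncard_of_injOn f hLR hinjL hRfin)
  have hint : L ∩ R = {p} := by
    ext x
    simp only [hL, hR, mem_inter_iff, mem_ofPred_eq, mem_singleton_iff]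
    constructor
    · rintro ⟨⟨h1, -⟩, ⟨h2, -⟩⟩
      exact le_antisymm h1.2 h2.1
    · rintro rfl
      have hfix : IsPeriodicPt f (2 * n) x := iterate_fixed hr.map_fixed _
      exact ⟨⟨⟨hlt.le, le_rfl⟩, hfix⟩, ⟨⟨le_rfl, hr.fixed_lt.le⟩, hfix⟩⟩
  have hper : per f (2 * n) = insert 0 (L ∪ R) := by
    ext x
    simp only [per, hL, hR, mem_ofPred_eq, mem_insert_iff, mem_union]
    constructor
    · rintro ⟨hx, hpx⟩
      by_cases h0 : x = 0
      · exact Or.inl h0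
      · rcases hr.mem_or_mem_of_isPeriodicPt (by omega) hx hpx h0 with h | h
        · exact Or.inr (Or.inl ⟨h, hpx⟩)
        · exact Or.inr (Or.inr ⟨h, hpx⟩)
    · rintro (rfl | ⟨h, hpx⟩ | ⟨h, hpx⟩)
      · exact ⟨⟨le_rfl, zero_le_one⟩, iterate_fixed hU.map_zero _⟩
      · exact ⟨Ioo_subset_Icc_self (hr.mem_Ioo_of_mem h), hpx⟩
      · have := hr.mem_Ioo_of_mem_right h
        exact ⟨⟨(hU.crit_mem.1.trans this.1).le, this.2.le⟩, hpx⟩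
  have h0 : (0 : ℝ) ∉ L ∪ R := by
    rintro (h | h)
    · exact absurd (hr.mem_Ioo_of_mem h.1).1 (lt_irrefl _)
    · exact absurd (hU.crit_mem.1.trans (hr.mem_Ioo_of_mem_right h.1).1) (lt_irrefl _)
  have hcard := Set.ncard_union_add_ncard_inter L R hLfin hRfin
  rw [hint, Set.ncard_singleton, hRcard] at hcard
  rw [hper]
  refine ⟨(hLfin.union hRfin).insert 0, ?_⟩
  rw [Set.ncard_insert_of_notMem h0 (hLfin.union hRfin), hcard, hLcard]
  ring

/-- A periodic orbit of `f` of even period other than two halves its period under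
renormalization. -/
theorem exists_minimalPeriod_renorm (hr : Renormalizable f c p q) {n : ℕ} (hn : 0 < n)
    (h : ∃ x ∈ Icc (0 : ℝ) 1, minimalPeriod f x = 2 * n) :
    ∃ t ∈ Icc (0 : ℝ) 1, minimalPeriod (renorm f p q) t = n := by
  have hU := hr.isSUnimodal.toIsUnimodal
  obtain ⟨x, hx, hpx⟩ := h
  have hpp : IsPeriodicPt f (2 * n) x := hpx ▸ isPeriodicPt_minimalPeriod f x
  have hx0 : x ≠ 0 := by
    rintro rfl
    rw [minimalPeriod_eq_one_iff_isFixedPt.2 hU.map_zero] at hpx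
    omega
  obtain ⟨y, hy, hpy⟩ : ∃ y ∈ Icc q p, minimalPeriod f y = 2 * n := by
    rcases hr.mem_or_mem_of_isPeriodicPt (by omega) hx hpp hx0 with h | h
    · exact ⟨x, h, hpx⟩
    · exact ⟨f x, hr.mapsTo_left h, by
        rw [minimalPeriod_apply (mk_mem_periodicPts (by omega) hpp), hpx]⟩
  have hyy := chart_chartInv hr.lt y
  refine ⟨chartInv p q y, (chart_mem_Icc hr.lt).1 (by rwa [hyy]), ?_⟩
  have h1 : minimalPeriod (renorm f p q) (chartInv p q y) = minimalPeriod (f^[2]) y := by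
    rw [minimalPeriod_eq_minimalPeriod_iff]
    intro k
    rw [hr.isPeriodicPt_renorm_iff, hyy, IsPeriodicPt, IsPeriodicPt, iterate_mul]
  rw [h1, minimalPeriod_iterate_eq_div_gcd two_ne_zero, hpy, Nat.gcd_comm,
    Nat.gcd_mul_right_right, Nat.mul_div_cancel_left _ two_pos]

end Renormalizable

/-- The orbit `f c, f (f c), …` follows the sequence `s`: the points with symbol `1` lie in
`[c, ∞)`, those with symbol `0` in `(-∞, c]`. Both symbols are allowed for the point `c`, which
makes the notion stable under the orientation-reversing renormalization. -/
def Follows (f : ℝ → ℝ) (c : ℝ) (s : ℕ → ℕ) : Prop :=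
  ∀ i, (s i = 1 → c ≤ f^[i + 1] c) ∧ (s i = 0 → f^[i + 1] c ≤ c)

/-- The sequence `s` is the image of `s'` under the substitution `1 → 10`, `0 → 11`. -/
def IsDoubled (s s' : ℕ → ℕ) : Prop := (∀ i, s (2 * i) = 1) ∧ ∀ i, s (2 * i + 1) = 1 - s' i

/-- If `f c > c` and the critical orbit follows a doubled sequence, then `f` can be renormalized.
If `f (f c)` were to the left of `q`, all points of the critical orbit of odd index `≥ 3` would lie
in `[c, p)`, and those of even index `≥ 4` to the right of `p`. -/
theorem Follows.exists_renormalizable {f : ℝ → ℝ} {c : ℝ} {s s' : ℕ → ℕ} (hs : Follows f c s)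
    (hf : IsSUnimodal f c) (hc1 : c < f c) (hd : IsDoubled s s') (h0 : s' 0 = 1) {k : ℕ}
    (hk : 0 < k) (hk1 : s' k = 1) : ∃ p q, Renormalizable f c p q := by
  have hU := hf.toIsUnimodal
  have hc := hU.crit_mem
  obtain ⟨p, hp, hfp, hpc1⟩ := hf.exists_fixed hc1
  obtain ⟨q, hq, hfq⟩ := intermediate_value_Icc hc.1.le
    (hU.continuousOn.mono (Icc_subset_Icc_right hc.2.le))
    (show p ∈ Icc (f 0) (f c) from ⟨by rw [hU.map_zero]; exact (hc.1.trans hp.1).le, hpc1.le⟩)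
  have hq0 : q ≠ 0 := by rintro rfl; rw [hU.map_zero] at hfq; linarith [hc.1, hp.1]
  have hqc : q ≠ c := by rintro rfl; exact hpc1.ne' hfq
  have hle : f (f c) ≤ c := (hs 1).2 (by rw [show 1 = 2 * 0 + 1 from rfl, hd.2, h0])
  refine ⟨p, q, hf, hp, hfp, hpc1, ⟨lt_of_le_of_ne hq.1 hq0.symm, lt_of_le_of_ne hq.2 hqc⟩, hfq,
    ?_, hle⟩
  by_contra! hlt
  have hpI : p ∈ Icc c 1 := ⟨hp.1.le, hp.2.le⟩
  have horb : ∀ i, f^[i] c ∈ Icc (0 : ℝ) 1 := fun i => hU.mapsTo.iterate i hU.crit_mem_Icc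
  -- a point of `[c, p)` is mapped to the right of `p`
  have hstep : ∀ i, f^[2 * i + 1] c < p → p < f^[2 * i + 2] c := by
    intro i hi
    have h1 : c ≤ f^[2 * i + 1] c := (hs (2 * i)).1 (hd.1 i)
    rw [iterate_succ_apply' f (2 * i + 1)]
    conv_lhs => rw [← hfp]
    exact hU.strictAntiOn ⟨h1, (horb _).2⟩ hpI hi
  have hodd : ∀ i, f^[2 * (i + 1) + 1] c < p := by
    intro i
    induction i with
    | zero =>
      rw [← hfq]
      exact hU.strictMonoOn ⟨(horb 2).1, hlt.le.trans hq.2⟩ hq hlt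
    | succ i ih =>
      have h1 := hstep _ ih
      rw [show 2 * (i + 1 + 1) + 1 = (2 * (i + 1) + 2) + 1 by ring, iterate_succ_apply']
      conv_rhs => rw [← hfp]
      exact hU.strictAntiOn hpI ⟨(hp.1.trans h1).le, (horb _).2⟩ h1
  have h1 := hstep k (by have := hodd (k - 1); rwa [Nat.sub_add_cancel hk] at this)
  have h2 : f^[2 * k + 2] c ≤ c := (hs (2 * k + 1)).2 (by rw [hd.2, hk1])
  linarith [hp.1]

/-- Renormalization undoes the substitution. -/
theorem Follows.follows_renorm {f : ℝ → ℝ} {c p q : ℝ} {s s' : ℕ → ℕ} (hs : Follows f c s)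
    (hr : Renormalizable f c p q) (hd : IsDoubled s s') :
    Follows (renorm f p q) (chartInv p q c) s' := by
  intro i
  have hit : chart p q ((renorm f p q)^[i + 1] (chartInv p q c)) = f^[2 * i + 1 + 1] c := by
    rw [hr.chart_iterate_renorm, chart_chartInv hr.lt, show 2 * (i + 1) = 2 * i + 1 + 1 by ring]
  have h := hs (2 * i + 1)
  rw [hd.2] at h
  constructor
  · intro h1
    rw [← chart_le_chart hr.lt, hit, chart_chartInv hr.lt]
    exact h.2 (by rw [h1])
  · intro h1
    rw [← chart_le_chart hr.lt, hit, chart_chartInv hr.lt]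
    exact h.1 (by rw [h1])

/-! ### The sequences of the cascade -/

theorem word_le_one (m : ℕ) : ∀ a ∈ word m, a ≤ 1 := by
  intro a ha
  cases m with
  | zero => simp [word] at ha; omega
  | succ m =>
    simp only [word, List.mem_flatMap, subst] at ha
    obtain ⟨b, -, hb⟩ := ha
    split_ifs at hb <;> simp at hb <;> omega

theorem getD_word_le_one (m i : ℕ) : (word m).getD i 0 ≤ 1 := by
  by_cases h : i < (word m).length
  · rw [List.getD_eq_getElem _ _ h]
    exact word_le_one m _ (List.getElem_mem h)
  · rw [List.getD_eq_default _ _ (not_lt.1 h)]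
    exact zero_le_one

theorem getD_flatMap_subst {l : List ℕ} (hl : ∀ a ∈ l, a ≤ 1) {i : ℕ} (hi : i < l.length) :
    (l.flatMap subst).getD (2 * i) 0 = 1 ∧
      (l.flatMap subst).getD (2 * i + 1) 0 = 1 - l.getD i 0 := by
  induction l generalizing i with
  | nil => simp at hi
  | cons a l ih =>
    have ha : subst a = [1, 1 - a] := by
      have : a ≤ 1 := hl a (by simp)
      interval_cases a <;> rfl
    rw [List.flatMap_cons, ha]
    cases i with
    | zero => simp
    | succ i =>
      have h := ih (fun b hb => hl b (by simp [hb])) (i := i) (by simpa using hi)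
      simpa [mul_add] using h

theorem K_le_one (j i : ℕ) : K j i ≤ 1 := getD_word_le_one _ _

theorem Kinf_le_one (i : ℕ) : Kinf i ≤ 1 := getD_word_le_one _ _

theorem isDoubled_K {j : ℕ} (hj : 1 ≤ j) : IsDoubled (K (j + 1)) (K j) := by
  obtain ⟨m, rfl⟩ : ∃ m, j = m + 1 := ⟨j - 1, by omega⟩
  have key : ∀ i, K (m + 1 + 1) (2 * i) = 1 ∧ K (m + 1 + 1) (2 * i + 1) = 1 - K (m + 1) i := by
    intro i
    have hlt : i % 2 ^ m < (word m).length := by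
      rw [word_length]; exact Nat.mod_lt _ (by positivity)
    have h := getD_flatMap_subst (word_le_one m) hlt
    have h0 : (2 * i) % 2 ^ (m + 1) = 2 * (i % 2 ^ m) := by rw [pow_succ', Nat.mul_mod_mul_left]
    have h1 : (2 * i + 1) % 2 ^ (m + 1) = 2 * (i % 2 ^ m) + 1 := by
      have := Nat.mod_lt i (show 0 < 2 ^ m by positivity)
      rw [pow_succ']
      conv_lhs => rw [← Nat.div_add_mod i (2 ^ m), mul_add, ← mul_assoc, add_assoc,
        Nat.mul_add_mod, Nat.mod_eq_of_lt (by omega)]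
    simp only [K, Nat.add_sub_cancel, word_length, h0, h1]
    exact h
  exact ⟨fun i => (key i).1, fun i => (key i).2⟩

theorem isDoubled_Kinf : IsDoubled Kinf Kinf := by
  constructor
  · intro i
    rw [← K_eq_Kinf (show 2 * i < 2 * i + 1 + 1 by omega)]
    exact (isDoubled_K (by omega)).1 i
  · intro i
    rw [← K_eq_Kinf (show 2 * i + 1 < 2 * i + 2 + 1 by omega),
      ← K_eq_Kinf (show i < 2 * i + 2 by omega)]
    exact (isDoubled_K (by omega)).2 i

theorem K_even {j : ℕ} (hj : 1 ≤ j) (i : ℕ) : K j (2 * i) = 1 := by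
  rcases hj.eq_or_lt with rfl | h
  · simp [K, word, Nat.mod_one]
  · obtain ⟨m, rfl⟩ : ∃ m, j = m + 1 := ⟨j - 1, by omega⟩
    exact (isDoubled_K (by omega)).1 i

theorem K_one (i : ℕ) : K 1 i = 1 := by simp [K, word, Nat.mod_one]

/-- A sequence that is doubled from itself is not periodic: an odd period would make it constant,
and an even period could be halved. -/
theorem not_periodic_Kinf {n : ℕ} (hn : 0 < n) : ¬ ∀ i, Kinf (i + n) = Kinf i := by
  induction n using Nat.strong_induction_on with
  | _ n ih =>
    intro hper
    rcases Nat.even_or_odd' n with ⟨m, rfl | rfl⟩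
    · refine ih m (by omega) (by omega) fun i => ?_
      have h := hper (2 * i + 1)
      rw [show 2 * i + 1 + 2 * m = 2 * (i + m) + 1 by ring, isDoubled_Kinf.2, isDoubled_Kinf.2] at h
      have h1 := Kinf_le_one i
      have h2 := Kinf_le_one (i + m)
      omega
    · have h := hper 1
      have h0 : Kinf 0 = 1 := isDoubled_Kinf.1 0
      have h1 : Kinf 1 = 1 - Kinf 0 := isDoubled_Kinf.2 0
      rw [show 1 + (2 * m + 1) = 2 * (m + 1) by ring, isDoubled_Kinf.1, h1, h0] at h
      omega

/-! ### The parameter determines the kneading sequence -/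

theorem digit_le_one (s : ℕ → ℕ) (k : ℕ) : digit s k ≤ 1 := by unfold digit; omega

theorem digit_succ (s : ℕ → ℕ) (k : ℕ) : digit s (k + 1) = (digit s k + s k) % 2 := by
  simp [digit, Finset.sum_range_succ]

theorem hasSum_half_pow_succ : HasSum (fun n : ℕ => (1 : ℝ) / 2 ^ (n + 1)) 1 := by
  have h := hasSum_geometric_two.mul_left (1 / 2 : ℝ)
  rw [show (1 / 2 : ℝ) * 2 = 1 by norm_num] at h
  refine h.congr_fun (fun n => ?_)
  rw [pow_succ', one_div_pow]
  field_simp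

theorem summable_digit (d : ℕ → ℕ) (hd : ∀ i, d i ≤ 1) :
    Summable fun k : ℕ => (d k : ℝ) / 2 ^ (k + 1) := by
  refine Summable.of_nonneg_of_le (fun k => by positivity) (fun k => ?_)
    hasSum_half_pow_succ.summable
  have : (d k : ℝ) ≤ 1 := by exact_mod_cast hd k
  gcongr

/-- Two different binary expansions of the same number are eventually constant. -/
theorem eventually_const_of_tsum_eq {d e : ℕ → ℕ} (hd : ∀ i, d i ≤ 1) (he : ∀ i, e i ≤ 1)
    (hsum : ∑' k : ℕ, (d k : ℝ) / 2 ^ (k + 1) = ∑' k : ℕ, (e k : ℝ) / 2 ^ (k + 1)) {k : ℕ}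
    (hlt : ∀ i < k, d i = e i) (hdk : d k = 1) (hek : e k = 0) {i : ℕ} (hi : k < i) :
    d i = 0 ∧ e i = 1 := by
  set a : ℕ → ℝ := fun n => (d n : ℝ) / 2 ^ (n + 1) - (e n : ℝ) / 2 ^ (n + 1) with ha
  have hsa : Summable a := (summable_digit d hd).sub (summable_digit e he)
  have hzero : ∑' n, a n = 0 := by
    rw [ha, (summable_digit d hd).tsum_sub (summable_digit e he), hsum, sub_self]
  have hsplit := hsa.sum_add_tsum_nat_add (k + 1)
  have hfirst : ∑ n ∈ Finset.range (k + 1), a n = 1 / 2 ^ (k + 1) := by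
    rw [Finset.sum_range_succ, Finset.sum_eq_zero fun n hn => by
      simp [ha, hlt n (Finset.mem_range.1 hn)]]
    simp [ha, hdk, hek]
  rw [hzero, hfirst] at hsplit
  have hgeo : HasSum (fun n : ℕ => (1 : ℝ) / 2 ^ (n + (k + 1) + 1)) (1 / 2 ^ (k + 1)) := by
    have h := hasSum_half_pow_succ.mul_left (1 / 2 ^ (k + 1) : ℝ)
    rw [mul_one] at h
    refine h.congr_fun (fun n => ?_)
    rw [div_mul_div_comm, one_mul, ← pow_add]
    congr 2; ring
  have htail : HasSum (fun n => a (n + (k + 1)) + 1 / 2 ^ (n + (k + 1) + 1)) 0 := by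
    have h := (((summable_nat_add_iff (k + 1)).2 hsa).hasSum).add hgeo
    rwa [show ∑' n, a (n + (k + 1)) + 1 / 2 ^ (k + 1) = 0 by linarith] at h
  have hform : ∀ n, a n + 1 / 2 ^ (n + 1) = ((d n : ℝ) + (1 - e n)) / 2 ^ (n + 1) := fun n => by
    simp only [ha]; ring
  have he' : ∀ n, (e n : ℝ) ≤ 1 := fun n => by exact_mod_cast he n
  have hall := (hasSum_zero_iff_of_nonneg fun n => by
    rw [hform]
    have := he' (n + (k + 1))
    have : (0 : ℝ) ≤ 1 - e (n + (k + 1)) := by linarith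
    positivity).1 htail
  have hi' := congrFun hall (i - (k + 1))
  simp only [hform, show i - (k + 1) + (k + 1) = i by omega, Pi.zero_apply] at hi'
  rw [div_eq_zero_iff, or_iff_left (by positivity)] at hi'
  have h1 := he' i
  have h2 : (0 : ℝ) ≤ d i := by positivity
  refine ⟨?_, ?_⟩
  · have : (d i : ℝ) = 0 := by linarith
    exact_mod_cast this
  · have : (e i : ℝ) = 1 := by linarith
    exact_mod_cast this

theorem eq_zero_of_digit_eq {s : ℕ → ℕ} (hs : ∀ i, s i ≤ 1) {i : ℕ}
    (h : digit s (i + 1) = digit s i) : s i = 0 := by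
  have h1 := hs i
  have h2 := digit_le_one s i
  rw [digit_succ] at h
  omega

/-- A sequence that contains infinitely many symbols `1` is determined by its parameter. -/
theorem eq_of_tau_eq {s s' : ℕ → ℕ} (hs : ∀ i, s i ≤ 1) (hs' : ∀ i, s' i ≤ 1)
    (hinf : ∀ N, ∃ i, N ≤ i ∧ s' i = 1) (h : tau s = tau s') : s = s' := by
  have hdig : ∀ k, digit s (k + 1) = digit s' (k + 1) := by
    by_contra! hne
    classical
    let k := Nat.find hne
    have hk : digit s (k + 1) ≠ digit s' (k + 1) := Nat.find_spec hne
    have hlt : ∀ i < k, digit s (i + 1) = digit s' (i + 1) := fun i hi =>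
      not_not.1 (Nat.find_min hne hi)
    have hconst : ∀ i, k < i → digit s' (i + 1 + 1) = digit s' (i + 1) := by
      intro i hi
      have h1 := digit_le_one s (k + 1)
      have h2 := digit_le_one s' (k + 1)
      rcases Nat.lt_or_ge (digit s' (k + 1)) (digit s (k + 1)) with hc | hc
      · have key := fun {i : ℕ} (hi : k < i) => eventually_const_of_tsum_eq
          (d := fun i => digit s (i + 1)) (e := fun i => digit s' (i + 1))
          (fun i => digit_le_one _ _) (fun i => digit_le_one _ _) h hlt (by omega) (by omega) hi
        rw [(key hi).2, (key (hi.trans (Nat.lt_succ_self i))).2]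
      · have key := fun {i : ℕ} (hi : k < i) => eventually_const_of_tsum_eq
          (d := fun i => digit s' (i + 1)) (e := fun i => digit s (i + 1))
          (fun i => digit_le_one _ _) (fun i => digit_le_one _ _) h.symm
          (fun i hi => (hlt i hi).symm) (by omega) (by omega) hi
        rw [(key hi).1, (key (hi.trans (Nat.lt_succ_self i))).1]
    obtain ⟨i, hi, hi1⟩ := hinf (k + 2)
    obtain ⟨i, rfl⟩ : ∃ n, i = n + 1 := ⟨i - 1, by omega⟩
    rw [eq_zero_of_digit_eq hs' (hconst i (by omega))] at hi1
    exact absurd hi1 (by norm_num)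
  have hdig' : ∀ k, digit s k = digit s' k := fun k => by
    cases k with
    | zero => rfl
    | succ k => exact hdig k
  funext i
  have h1 := digit_succ s i
  have h2 := digit_succ s' i
  rw [hdig, hdig'] at h1
  have := hs i
  have := hs' i
  omega

theorem tendsto_tauJ : Tendsto tauJ atTop (𝓝 tauInf) := by
  refine tendsto_tsum_of_dominated_convergence hasSum_half_pow_succ.summable (fun k => ?_)
    (Eventually.of_forall fun j k => ?_)
  · refine tendsto_const_nhds.congr' ?_
    filter_upwards [eventually_ge_atTop (k + 1)] with j hj
    have : digit (K j) (k + 1) = digit Kinf (k + 1) := by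
      unfold digit
      rw [Finset.sum_congr rfl fun i hi => K_eq_Kinf ((Finset.mem_range.1 hi).trans_le hj)]
    rw [this]
  · have : (digit (K j) (k + 1) : ℝ) ≤ 1 := by exact_mod_cast digit_le_one _ _
    rw [Real.norm_of_nonneg (by positivity)]
    gcongr

theorem kneading_le_one (f : ℝ → ℝ) (c : ℝ) (i : ℕ) : kneading f c i ≤ 1 := by
  unfold kneading itinerary; split_ifs <;> omega

theorem follows_kneading (f : ℝ → ℝ) (c : ℝ) : Follows f c (kneading f c) := by
  intro i
  simp only [kneading, itinerary, iterate_succ_apply]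
  split_ifs with h
  · exact ⟨fun h' => absurd h' (by norm_num), fun _ => h.le⟩
  · exact ⟨fun _ => not_lt.1 h, fun h' => absurd h' (by norm_num)⟩

theorem kneading_eq_K {f : ℝ → ℝ} {c : ℝ} {j : ℕ} (hj : 1 ≤ j) (h : parameter f c = tauJ j) :
    kneading f c = K j :=
  eq_of_tau_eq (kneading_le_one f c) (K_le_one j) (fun N => ⟨2 * N, by omega, K_even hj N⟩) h

theorem kneading_eq_Kinf {f : ℝ → ℝ} {c : ℝ} (h : parameter f c = tauInf) :
    kneading f c = Kinf :=
  eq_of_tau_eq (kneading_le_one f c) Kinf_le_one (fun N => ⟨2 * N, by omega, isDoubled_Kinf.1 N⟩) h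

/-- At the parameter `τ_∞` the critical point is not periodic. -/
theorem iterate_crit_ne {f : ℝ → ℝ} {c : ℝ} (h : parameter f c = tauInf) (n : ℕ) :
    f^[n + 1] c ≠ c := by
  intro hc
  refine not_periodic_Kinf n.succ_pos fun i => ?_
  have hk : ∀ i, kneading f c i = if f^[i + 1] c < c then 0 else 1 := fun _ => rfl
  have hit : f^[i + n.succ + 1] c = f^[i + 1] c := by
    rw [show i + n.succ + 1 = i + 1 + (n + 1) by omega, iterate_add_apply f (i + 1), hc]
  rw [← kneading_eq_Kinf h, hk, hk, hit]

/-! ### Counting periodic points along the cascade -/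

/-- The count at the parameter `τ_j`, by induction on the number of renormalizations. -/
theorem ncard_per_of_follows_K {j : ℕ} (hj : 1 ≤ j) : ∀ {f : ℝ → ℝ} {c : ℝ}, IsSUnimodal f c →
    Follows f c (K j) → (∃ x ∈ Icc (0 : ℝ) 1, minimalPeriod f x = 2 ^ j) →
    ∀ {n : ℕ}, 0 < n → (per f n).Finite ∧ (per f n).ncard = cascadeCount j n := by
  induction j, hj using Nat.le_induction with
  | base =>
    intro f c hf hs ⟨x, hx, hpx⟩ n hn
    have hc1 : c ≤ f c := (hs 0).1 (K_one 0)
    rcases hc1.eq_or_lt with h | h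
    · have := minimalPeriod_eq_one_iff_isFixedPt.2
        (hf.isFixedPt_of_isPeriodicPt h.symm (by norm_num) hx
          (hpx ▸ isPeriodicPt_minimalPeriod f x))
      omega
    · exact hf.ncard_per_of_period_two h ((hs 1).1 (K_one 1)) hx hpx hn
  | succ j hj ih =>
    intro f c hf hs ⟨x, hx, hpx⟩ n hn
    have hc1 : c ≤ f c := (hs 0).1 (K_even (by omega) 0)
    rcases hc1.eq_or_lt with h | h
    · have h1 := minimalPeriod_eq_one_iff_isFixedPt.2
        (hf.isFixedPt_of_isPeriodicPt h.symm (by positivity) hx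
          (hpx ▸ isPeriodicPt_minimalPeriod f x))
      have h2 := Nat.one_lt_two_pow j.succ_ne_zero
      omega
    · obtain ⟨p, q, hr⟩ := hs.exists_renormalizable hf h (isDoubled_K hj) (K_even hj 0)
        two_pos (K_even hj 1)
      rcases Nat.even_or_odd' n with ⟨m, rfl | rfl⟩
      · obtain ⟨h1, h2⟩ := ih hr.isSUnimodal_renorm (hs.follows_renorm hr (isDoubled_K hj))
          (hr.exists_minimalPeriod_renorm (by positivity) ⟨x, hx, by rw [hpx, pow_succ']⟩)
          (n := m) (by omega)
        obtain ⟨h3, h4⟩ := hr.ncard_per_even (by omega) h1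
        exact ⟨h3, by rw [h4, h2, cascadeCount_succ_two_mul]⟩
      · obtain ⟨h3, h4⟩ := hr.ncard_per_odd ⟨m, rfl⟩
        exact ⟨h3, by rw [h4, cascadeCount_of_odd _ ⟨m, rfl⟩]⟩

/-- The count at the parameter `τ_∞`: as many renormalizations are possible as needed. -/
theorem ncard_per_of_follows_Kinf (j : ℕ) : ∀ {f : ℝ → ℝ} {c : ℝ}, IsSUnimodal f c →
    Follows f c Kinf → (∀ k, f^[k + 1] c ≠ c) →
    ∀ {n : ℕ}, 0 < n → n < 2 ^ j → (per f n).Finite ∧ (per f n).ncard = cascadeCount j n := by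
  induction j with
  | zero => intro f c _ _ _ n hn hn'; omega
  | succ j ih =>
    intro f c hf hs hne n hn hnj
    have h : c < f c := lt_of_le_of_ne ((hs 0).1 (isDoubled_Kinf.1 0)) (hne 0).symm
    obtain ⟨p, q, hr⟩ := hs.exists_renormalizable hf h isDoubled_Kinf (isDoubled_Kinf.1 0)
      two_pos (isDoubled_Kinf.1 1)
    rcases Nat.even_or_odd' n with ⟨m, rfl | rfl⟩
    · have hne' : ∀ k, (renorm f p q)^[k + 1] (chartInv p q c) ≠ chartInv p q c := by
        intro k hk
        have h1 := hr.chart_iterate_renorm (k + 1) (chartInv p q c)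
        rw [hk, chart_chartInv hr.lt] at h1
        exact hne (2 * k + 1) h1.symm
      obtain ⟨h1, h2⟩ := ih hr.isSUnimodal_renorm (hs.follows_renorm hr isDoubled_Kinf) hne'
        (n := m) (by omega) (by rw [pow_succ'] at hnj; omega)
      obtain ⟨h3, h4⟩ := hr.ncard_per_even (by omega) h1
      exact ⟨h3, by rw [h4, h2, cascadeCount_succ_two_mul]⟩
    · obtain ⟨h3, h4⟩ := hr.ncard_per_odd ⟨m, rfl⟩
      exact ⟨h3, by rw [h4, cascadeCount_of_odd _ ⟨m, rfl⟩]⟩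

theorem cascadeCount_le (j : ℕ) {n : ℕ} (hn : 0 < n) : cascadeCount j n ≤ 2 * n := by
  induction j generalizing n with
  | zero => simp [cascadeCount]; omega
  | succ j ih =>
    rcases Nat.even_or_odd' n with ⟨m, rfl | rfl⟩
    · rw [cascadeCount_succ_two_mul]
      have := ih (n := m) (by omega)
      omega
    · rw [cascadeCount_of_odd _ ⟨m, rfl⟩]
      omega

/-! ### Zeta functions -/

theorem norm_zeta_term_le {z : ℂ} {n N : ℕ} (hn : 0 < n) (hN : N ≤ 2 * n) :
    ‖z ^ n / (n : ℂ) * (N : ℂ)‖ ≤ 2 * ‖z‖ ^ n := by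
  have hn' : (0 : ℝ) < n := by exact_mod_cast hn
  have hN' : (N : ℝ) ≤ 2 * n := by exact_mod_cast hN
  rw [norm_mul, norm_div, norm_pow, Complex.norm_natCast, Complex.norm_natCast]
  calc ‖z‖ ^ n / n * N ≤ ‖z‖ ^ n / n * (2 * n) := by gcongr
    _ = 2 * ‖z‖ ^ n := by field_simp

theorem summable_two_mul_pow_succ {z : ℂ} (hz : ‖z‖ < 1) :
    Summable fun n : ℕ => 2 * ‖z‖ ^ (n + 1) :=
  ((summable_nat_add_iff 1).2 (summable_geometric_of_lt_one (norm_nonneg z) hz)).mul_left 2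

theorem zetaDefined_of_ncard_le {f : ℝ → ℝ} (hfin : ∀ n, 0 < n → (per f n).Finite)
    (hcard : ∀ n, 0 < n → (per f n).ncard ≤ 2 * n) : ZetaDefined f :=
  ⟨hfin, fun _ hz => Summable.of_nonneg_of_le (fun _ => norm_nonneg _)
    (fun n => norm_zeta_term_le n.succ_pos (hcard _ n.succ_pos)) (summable_two_mul_pow_succ hz)⟩

theorem one_sub_ne_zero_of_norm_lt {w : ℂ} (hw : ‖w‖ < 1) : 1 - w ≠ 0 := by
  intro h
  rw [← sub_eq_zero.1 h, norm_one] at hw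
  exact lt_irrefl _ hw

theorem norm_pow_two_pow_lt {z : ℂ} (hz : ‖z‖ < 1) (m : ℕ) : ‖z ^ 2 ^ m‖ < 1 := by
  rw [norm_pow]
  exact pow_lt_one₀ (norm_nonneg z) hz (by positivity)

theorem cascadePoly_eval (j : ℕ) (z : ℂ) :
    (cascadePoly j).eval z = (1 - z) * ∏ n ∈ Finset.range (j + 1), (1 - z ^ 2 ^ n) := by
  simp [cascadePoly, Polynomial.eval_prod]

/-- The contribution of one periodic orbit of period `d` to the logarithm of the zeta function. -/
theorem hasSum_orbit {d : ℕ} (hd : 0 < d) {z : ℂ} (hz : ‖z ^ d‖ < 1) :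
    HasSum (fun n : ℕ => z ^ n / (n : ℂ) * ((if d ∣ n then d else 0 : ℕ) : ℂ))
      (-Complex.log (1 - z ^ d)) := by
  have hinj : Injective fun k : ℕ => d * k := 
    fun _ _ h => Nat.eq_of_mul_eq_mul_left hd h
  rw [← hinj.hasSum_iff]
  · refine (Complex.hasSum_taylorSeries_neg_log hz).congr_fun (fun k => ?_)
    have hd' : (d : ℂ) ≠ 0 := by exact_mod_cast hd.ne'
    simp only [comp, dvd_mul_right, if_true, Nat.cast_mul, pow_mul]
    rcases eq_or_ne k 0 with rfl | hk
    · simp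
    · have hk' : (k : ℂ) ≠ 0 := by exact_mod_cast hk
      field_simp
  · intro n hn
    have : ¬ d ∣ n := fun ⟨k, hk⟩ => hn ⟨k, hk.symm⟩
    simp [this]

theorem exp_tsum_cascadeCount (j : ℕ) {z : ℂ} (hz : ‖z‖ < 1) :
    Complex.exp (∑' n : ℕ, z ^ (n + 1) / ((n + 1 : ℕ) : ℂ) * (cascadeCount j (n + 1) : ℂ))
      = ((cascadePoly j).eval z)⁻¹ := by
  have h0 := hasSum_orbit one_pos (show ‖z ^ 1‖ < 1 by rwa [pow_one])
  have h1 := hasSum_sum (s := Finset.range (j + 1)) fun m _ =>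
    hasSum_orbit (d := 2 ^ m) (by positivity) (norm_pow_two_pow_lt hz m)
  have h2 := (hasSum_nat_add_iff' 1).2 (h0.add h1)
  have h3 : HasSum (fun n : ℕ => z ^ (n + 1) / ((n + 1 : ℕ) : ℂ) * (cascadeCount j (n + 1) : ℂ))
      (-Complex.log (1 - z) + ∑ m ∈ Finset.range (j + 1), -Complex.log (1 - z ^ 2 ^ m)) := by
    simp only [Finset.sum_range_one, pow_one, Nat.cast_zero, div_zero, zero_mul,
      Finset.sum_const_zero, add_zero, sub_zero] at h2
    refine h2.congr_fun fun n => ?_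
    simp only [cascadeCount, one_dvd, if_true, Nat.cast_add, Nat.cast_one, Nat.cast_sum,
      mul_add, Finset.mul_sum]
  rw [h3.tsum_eq, Complex.exp_add, Complex.exp_sum, cascadePoly_eval, mul_inv,
    ← Finset.prod_inv_distrib, Complex.exp_neg, Complex.exp_log (one_sub_ne_zero_of_norm_lt hz)]
  congr 1
  refine Finset.prod_congr rfl fun m _ => ?_
  rw [Complex.exp_neg, Complex.exp_log (one_sub_ne_zero_of_norm_lt (norm_pow_two_pow_lt hz m))]

theorem norm_eq_one_of_isRoot {j : ℕ} {z : ℂ} (h : (cascadePoly j).IsRoot z) : ‖z‖ = 1 := by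
  rw [Polynomial.IsRoot, cascadePoly_eval, mul_eq_zero, Finset.prod_eq_zero_iff] at h
  rcases h with h | ⟨m, -, h⟩
  · rw [← sub_eq_zero.1 h, norm_one]
  · exact Complex.norm_eq_one_of_pow_eq_one (sub_eq_zero.1 h).symm (by positivity)

theorem zeta_of_tauJ {j : ℕ} {f : ℝ → ℝ} {c : ℝ} (hj : 1 ≤ j) (hf : IsSUnimodal f c)
    (hpar : parameter f c = tauJ j) (hatt : HasPeriodicAttractor f (2 ^ j)) :
    ZetaDefined f ∧ ∀ z : ℂ, ‖z‖ < 1 → zeta f z = ((cascadePoly j).eval z)⁻¹ := by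
  have hs := follows_kneading f c
  rw [kneading_eq_K hj hpar] at hs
  obtain ⟨x, hx, hpx, -⟩ := hatt
  have hcount := fun {n : ℕ} (hn : 0 < n) => ncard_per_of_follows_K hj hf hs ⟨x, hx, hpx⟩ hn
  refine ⟨zetaDefined_of_ncard_le (fun n hn => (hcount hn).1)
    (fun n hn => (hcount hn).2.trans_le (cascadeCount_le j hn)), fun z hz => ?_⟩
  rw [← exp_tsum_cascadeCount j hz, zeta]
  simp only [zetaTerm, (hcount (Nat.succ_pos _)).2]

theorem summable_norm_pow_two_pow {r : ℝ} (h0 : 0 ≤ r) (h1 : r < 1) :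
    Summable fun n : ℕ => r ^ 2 ^ n :=
  Summable.of_nonneg_of_le (fun n => by positivity)
    (fun _ => pow_le_pow_of_le_one h0 h1.le Nat.lt_two_pow_self.le)
    (summable_geometric_of_lt_one h0 h1)

theorem multipliable_Xi {z : ℂ} (hz : ‖z‖ < 1) : Multipliable fun n : ℕ => 1 - z ^ 2 ^ n := by
  have : Summable fun n : ℕ => ‖-z ^ 2 ^ n‖ := by
    simpa only [norm_neg, norm_pow] using summable_norm_pow_two_pow (norm_nonneg z) hz
  simpa only [sub_eq_add_neg] using multipliable_one_add_of_summable this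

theorem tendsto_prod_Xi {z : ℂ} (hz : ‖z‖ < 1) :
    Tendsto (fun m => ∏ n ∈ Finset.range m, (1 - z ^ 2 ^ n)) atTop (𝓝 (Xi z)) :=
  (multipliable_Xi hz).tendsto_prod_tprod_nat

theorem tendstoLocallyUniformlyOn_cascadePoly :
    TendstoLocallyUniformlyOn (fun (j : ℕ) (z : ℂ) => (cascadePoly j).eval z)
      (fun z => (1 - z) * Xi z) atTop (Metric.ball 0 1) := by
  have hprod : HasProdLocallyUniformlyOn (fun (n : ℕ) (z : ℂ) => 1 + -z ^ 2 ^ n)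
      (fun z => ∏' n : ℕ, (1 + -z ^ 2 ^ n)) (Metric.ball 0 1) := by
    refine hasProdLocallyUniformlyOn_of_forall_compact Metric.isOpen_ball fun S hS hC => ?_
    obtain ⟨r, hr, hSr⟩ := exists_pos_lt_subset_ball one_pos hC.isClosed hS
    refine Summable.hasProdUniformlyOn_nat_one_add hC
      (summable_norm_pow_two_pow hr.1.le hr.2) (Eventually.of_forall fun n z hz => ?_)
      (fun n => by fun_prop)
    rw [norm_neg, norm_pow]
    exact pow_le_pow_left₀ (norm_nonneg z) (mem_ball_zero_iff.1 (hSr hz)).le _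
  have h1 := hprod.tendstoLocallyUniformlyOn_finsetRange
  have hcont : ContinuousOn (fun z : ℂ => ∏' n : ℕ, (1 + -z ^ 2 ^ n)) (Metric.ball 0 1) :=
    h1.continuousOn (Frequently.of_forall fun n => by fun_prop)
  have h2 : TendstoLocallyUniformlyOn
      (fun (j : ℕ) (z : ℂ) => ∏ n ∈ Finset.range (j + 1), (1 + -z ^ 2 ^ n))
      (fun z => ∏' n : ℕ, (1 + -z ^ 2 ^ n)) atTop (Metric.ball 0 1) := fun u hu x hx => by
    obtain ⟨t, ht, h⟩ := h1 u hu x hx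
    exact ⟨t, ht, (tendsto_add_atTop_nat 1).eventually h⟩
  have h3 : TendstoLocallyUniformlyOn (fun (_ : ℕ) (z : ℂ) => 1 - z) (fun z => 1 - z) atTop
      (Metric.ball 0 1) := fun u hu x _ =>
    ⟨univ, univ_mem, Eventually.of_forall fun _ _ _ => refl_mem_uniformity hu⟩
  have h4 := h3.mul₀ h2 (by fun_prop) hcont
  refine (h4.congr fun j z _ => ?_).congr_right fun z _ => ?_
  · simp only [cascadePoly_eval, sub_eq_add_neg, Pi.mul_apply]
  · simp only [Xi, sub_eq_add_neg, Pi.mul_apply]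

/-- At `τ_∞`: for fixed `n`, the counts for `τ_j` are eventually equal to the count for `τ_∞`, and
dominated convergence applies to the logarithms of the zeta functions. -/
theorem zeta_of_tauInf {f : ℝ → ℝ} {c : ℝ} (hf : IsSUnimodal f c) (hpar : parameter f c = tauInf) :
    ZetaDefined f ∧ ∀ z : ℂ, ‖z‖ < 1 → 1 / zeta f z = (1 - z) * Xi z := by
  have hs := follows_kneading f c
  rw [kneading_eq_Kinf hpar] at hs
  have hcount := fun {n j : ℕ} (hn : 0 < n) (hj : n < 2 ^ j) =>
    ncard_per_of_follows_Kinf j hf hs (iterate_crit_ne hpar) hn hj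
  refine ⟨zetaDefined_of_ncard_le (fun n hn => (hcount hn Nat.lt_two_pow_self).1)
    (fun n hn => (hcount hn Nat.lt_two_pow_self).2.trans_le (cascadeCount_le n hn)),
    fun z hz => ?_⟩
  have hlim : Tendsto (fun j => ∑' n : ℕ,
      z ^ (n + 1) / ((n + 1 : ℕ) : ℂ) * (cascadeCount j (n + 1) : ℂ)) atTop
      (𝓝 (∑' n : ℕ, zetaTerm f z (n + 1))) := by
    refine tendsto_tsum_of_dominated_convergence (summable_two_mul_pow_succ hz) (fun n => ?_)
      (Eventually.of_forall fun j n => norm_zeta_term_le n.succ_pos (cascadeCount_le j n.succ_pos))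
    refine tendsto_const_nhds.congr' ?_
    filter_upwards [eventually_ge_atTop (n + 1)] with j hj
    rw [zetaTerm, (hcount n.succ_pos
      (Nat.lt_two_pow_self.trans_le (Nat.pow_le_pow_right two_pos hj))).2]
  have h1 := ((Complex.continuous_exp.tendsto _).comp hlim).inv₀ (Complex.exp_ne_zero _)
  have h2 := tendstoLocallyUniformlyOn_cascadePoly.tendsto_at (mem_ball_zero_iff.2 hz)
  have h3 := h1.congr (f₂ := fun j => (cascadePoly j).eval z) fun j => by
    simp only [comp, exp_tsum_cascadeCount j hz, inv_inv]
  rw [one_div]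
  exact tendsto_nhds_unique h3 h2

theorem tendstoLocallyUniformlyOn_zeta {F : ℕ → ℝ → ℝ} {C : ℕ → ℝ} {f : ℝ → ℝ} {c : ℝ}
    (hF : ∀ j : ℕ, 1 ≤ j → IsSUnimodal (F j) (C j) ∧ parameter (F j) (C j) = tauJ j ∧
      HasPeriodicAttractor (F j) (2 ^ j))
    (hf : IsSUnimodal f c) (hpar : parameter f c = tauInf) :
    TendstoLocallyUniformlyOn (fun (j : ℕ) (z : ℂ) => zeta (F j) z) (zeta f) atTop
        (Metric.ball 0 1) ∧
      TendstoLocallyUniformlyOn (fun (j : ℕ) (z : ℂ) => 1 / zeta (F j) z)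
        (fun z => 1 / zeta f z) atTop (Metric.ball 0 1) := by
  have hzF : ∀ j, 1 ≤ j → ∀ z ∈ Metric.ball (0 : ℂ) 1,
      zeta (F j) z = ((cascadePoly j).eval z)⁻¹ := fun j hj z hz =>
    (zeta_of_tauJ hj (hF j hj).1 (hF j hj).2.1 (hF j hj).2.2).2 z (mem_ball_zero_iff.1 hz)
  have hzf : ∀ z ∈ Metric.ball (0 : ℂ) 1, (1 - z) * Xi z = (zeta f z)⁻¹ := fun z hz => by
    rw [← one_div]
    exact ((zeta_of_tauInf hf hpar).2 z (mem_ball_zero_iff.1 hz)).symm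
  -- only the indices `j ≥ 1` matter
  have hcongr : ∀ {G H : ℕ → ℂ → ℂ} {g : ℂ → ℂ},
      TendstoLocallyUniformlyOn G g atTop (Metric.ball 0 1) →
      (∀ j, 1 ≤ j → ∀ z ∈ Metric.ball (0 : ℂ) 1, G j z = H j z) →
      TendstoLocallyUniformlyOn H g atTop (Metric.ball 0 1) := fun hG hGH u hu x hx => by
    obtain ⟨t, ht, h⟩ := hG u hu x hx
    refine ⟨t ∩ Metric.ball 0 1, inter_mem ht self_mem_nhdsWithin, ?_⟩
    filter_upwards [h, eventually_ge_atTop 1] with j h1 hj y hy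
    rw [← hGH j hj y hy.2]
    exact h1 y hy.1
  have hP := tendstoLocallyUniformlyOn_cascadePoly
  have hcont : ContinuousOn (fun z => (1 - z) * Xi z) (Metric.ball 0 1) :=
    hP.continuousOn (Frequently.of_forall fun j => (cascadePoly j).continuous.continuousOn)
  have hinv := hP.inv₀ hcont fun z hz => by
    rw [hzf z hz]
    exact inv_ne_zero (Complex.exp_ne_zero _)
  constructor
  · exact hcongr (hinv.congr_right fun z hz => by simp only [Pi.inv_apply, hzf z hz, inv_inv])
      fun j hj z hz => by simp only [Pi.inv_apply, hzF j hj z hz]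
  · exact hcongr (hP.congr_right fun z hz => by simp only [hzf z hz, one_div])
      fun j hj z hz => by rw [hzF j hj z hz, one_div, inv_inv]

/-! ### The Thue–Morse signs -/

theorem sign_succ {s : ℕ → ℕ} (hs : ∀ i, s i ≤ 1) (k : ℕ) :
    sign s (k + 1) = (1 - 2 * (s k : ℤ)) * sign s k := by
  have h1 := hs k
  have h2 := digit_le_one s k
  unfold sign
  rw [digit_succ]
  interval_cases s k <;> interval_cases digit s k <;> norm_num

theorem sign_Kinf (k : ℕ) :
    sign Kinf (2 * k) = sign Kinf k ∧ sign Kinf (2 * k + 1) = -sign Kinf k := by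
  have hodd : ∀ k, sign Kinf (2 * k + 1) = -sign Kinf (2 * k) := fun k => by
    rw [sign_succ Kinf_le_one, isDoubled_Kinf.1]
    norm_num
  have heven : ∀ k, sign Kinf (2 * k) = sign Kinf k := fun k => by
    induction k with
    | zero => rfl
    | succ k ih =>
      rw [show 2 * (k + 1) = 2 * k + 1 + 1 by ring, sign_succ Kinf_le_one, hodd, ih,
        isDoubled_Kinf.2, sign_succ Kinf_le_one]
      have := Kinf_le_one k
      interval_cases Kinf k <;> norm_num
  exact ⟨heven k, by rw [hodd, heven]⟩

theorem prod_eq_sum_sign (m : ℕ) (z : ℂ) :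
    ∏ n ∈ Finset.range m, (1 - z ^ 2 ^ n)
      = ∑ k ∈ Finset.range (2 ^ m), (sign Kinf k : ℂ) * z ^ k := by
  induction m generalizing z with
  | zero => simp [sign, digit]
  | succ m ih =>
    have hpair : ∀ (g : ℕ → ℂ) (N : ℕ), ∑ k ∈ Finset.range (2 * N), g k
        = ∑ k ∈ Finset.range N, (g (2 * k) + g (2 * k + 1)) := fun g N => by
      induction N with
      | zero => simp
      | succ N ih => rw [mul_add, mul_one, Finset.sum_range_succ, Finset.sum_range_succ, ih,
          Finset.sum_range_succ, add_assoc]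
    have hsq : ∀ n, z ^ 2 ^ (n + 1) = (z ^ 2) ^ 2 ^ n := fun n => by rw [pow_succ', pow_mul]
    rw [Finset.prod_range_succ', pow_succ' 2 m, hpair]
    simp only [hsq]
    rw [ih (z ^ 2), Finset.sum_mul]
    refine Finset.sum_congr rfl fun k _ => ?_
    rw [(sign_Kinf k).1, (sign_Kinf k).2]
    push_cast
    ring

theorem hasSum_Xi {z : ℂ} (hz : ‖z‖ < 1) :
    HasSum (fun k : ℕ => (sign Kinf k : ℂ) * z ^ k) (Xi z) := by
  have hsum : Summable fun k : ℕ => (sign Kinf k : ℂ) * z ^ k := by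
    refine Summable.of_norm_bounded (summable_geometric_of_lt_one (norm_nonneg z) hz) fun k => ?_
    have h1 : ‖(sign Kinf k : ℂ)‖ = 1 := by
      have := digit_le_one Kinf k
      unfold sign
      interval_cases digit Kinf k <;> norm_num
    rw [norm_mul, norm_pow, h1, one_mul]
  have h1 := hsum.hasSum.tendsto_sum_nat.comp
    (tendsto_pow_atTop_atTop_of_one_lt (one_lt_two : (1 : ℕ) < 2))
  have h2 := (tendsto_prod_Xi hz).congr fun m => prod_eq_sum_sign m z
  rw [tendsto_nhds_unique h2 h1]
  exact hsum.hasSum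

end Feigenbaum

theorem mainTheorem4 :
    -- the zeta function of a unimodal map with parameter `τ_j`
    (∀ (j : ℕ) (f : ℝ → ℝ) (c : ℝ), 1 ≤ j → Feigenbaum.IsSUnimodal f c →
      Feigenbaum.parameter f c = Feigenbaum.tauJ j →
      Feigenbaum.HasPeriodicAttractor f (2 ^ j) →
        Feigenbaum.ZetaDefined f ∧
        ∀ z : ℂ, ‖z‖ < 1 → 1 / Feigenbaum.zeta f z = (Feigenbaum.cascadePoly j).eval z) ∧
    -- the zeros of the polynomials lie on the unit circle
    (∀ (j : ℕ) (z : ℂ), (Feigenbaum.cascadePoly j).IsRoot z → ‖z‖ = 1) ∧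
    -- the limit parameter
    Tendsto Feigenbaum.tauJ atTop (𝓝 Feigenbaum.tauInf) ∧
    -- the zeta function of a unimodal map with parameter `τ_∞`
    (∀ z : ℂ, ‖z‖ < 1 → Multipliable (fun n : ℕ => 1 - z ^ 2 ^ n)) ∧
    (∀ (f : ℝ → ℝ) (c : ℝ), Feigenbaum.IsSUnimodal f c →
      Feigenbaum.parameter f c = Feigenbaum.tauInf →
        Feigenbaum.ZetaDefined f ∧
        ∀ z : ℂ, ‖z‖ < 1 → 1 / Feigenbaum.zeta f z = (1 - z) * Feigenbaum.Xi z) ∧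
    -- convergence, of the polynomials and of the zeta functions
    TendstoLocallyUniformlyOn (fun (j : ℕ) (z : ℂ) => (Feigenbaum.cascadePoly j).eval z)
      (fun z => (1 - z) * Feigenbaum.Xi z) atTop (Metric.ball 0 1) ∧
    (∀ (F : ℕ → ℝ → ℝ) (C : ℕ → ℝ) (f : ℝ → ℝ) (c : ℝ),
      (∀ j : ℕ, 1 ≤ j → Feigenbaum.IsSUnimodal (F j) (C j) ∧
        Feigenbaum.parameter (F j) (C j) = Feigenbaum.tauJ j ∧
        Feigenbaum.HasPeriodicAttractor (F j) (2 ^ j)) →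
      Feigenbaum.IsSUnimodal f c → Feigenbaum.parameter f c = Feigenbaum.tauInf →
        TendstoLocallyUniformlyOn (fun (j : ℕ) (z : ℂ) => Feigenbaum.zeta (F j) z)
          (Feigenbaum.zeta f) atTop (Metric.ball 0 1) ∧
        TendstoLocallyUniformlyOn (fun (j : ℕ) (z : ℂ) => 1 / Feigenbaum.zeta (F j) z)
          (fun z => 1 / Feigenbaum.zeta f z) atTop (Metric.ball 0 1)) ∧
    -- the power series coefficients of `Ξ`
    (∀ z : ℂ, ‖z‖ < 1 →
      HasSum (fun k : ℕ => (Feigenbaum.sign Feigenbaum.Kinf k : ℂ) * z ^ k)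
        (Feigenbaum.Xi z)) := by
  refine ⟨fun j f c hj hf hpar hatt => ?_, fun j z => Feigenbaum.norm_eq_one_of_isRoot,
    Feigenbaum.tendsto_tauJ, fun z => Feigenbaum.multipliable_Xi,
    fun f c => Feigenbaum.zeta_of_tauInf, Feigenbaum.tendstoLocallyUniformlyOn_cascadePoly,
    fun F C f c => Feigenbaum.tendstoLocallyUniformlyOn_zeta, fun z => Feigenbaum.hasSum_Xi⟩
  obtain ⟨hdef, hzeta⟩ := Feigenbaum.zeta_of_tauJ hj hf hpar hatt
  exact ⟨hdef, fun z hz => by rw [hzeta z hz, one_div, inv_inv]⟩
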